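/- **Model.** Let $x_0\sim\mathcal N(\bar x_0,\sigma_{x_0}^2)$, $D_t\sim\mathcal N(\bar D_t,\sigma_{D_t}^2)$ and $\eta_t\sim\mathcal N(0,\sigma_{\eta_t}^2)$, $t=0,1,\dots$, be independent (variances may be $0$; the case of i.i.d. demands and i.i.d. noises is included). The inventory level and its observation satisfy $$x_{t+1}=x_t+a_t-D_t,\qquad y_t=x_t+\eta_t .$$ The action $a_t\in[0,\infty)$ is chosen by a (possibly randomized) policy on the basis of the observed history $h_t=(y_0,a_0,\dots,y_{t-1},a_{t-1},y_t)$. The one-step cost is $c_t(x,a)=\hat c(a)+\mathsf E\,h(x+a-D_t)$, where $\hat c(a)=K\mathbf 1_{\{a>0\}}+\tilde c a$ with $K,\tilde c\ge 0$, and $h:\mathbb R\to[0,\infty)$ is convex. The criterion is the expected total discounted cost $\mathsf E^\pi\sum_{t<T}\alpha^t c_t(x_t,a_t)\in[0,\infty]$ with $\alpha\ge 0$ and a finite or infinite horizon $T$. The *belief MDP* has the probability measures $z$ on $\mathbb R$ as states. If $x\sim z$ and the action is $a$, the next state $H_t(z,a,y')$ is the conditional distribution of $x'=x+a-D_t$ given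 $y'=x'+\eta_{t+1}$, with $y'$ distributed as the marginal. Its costs are $C_t(z,a)=\int c_t(x,a)\,z(dx)$, and its initial state is the conditional distribution of $x_0$ given $y_0$. With the convention $0/0=0$ put $$\sigma_0^2=\frac{\sigma_{x_0}^2\sigma_{\eta_0}^2}{\sigma_{x_0}^2+\sigma_{\eta_0}^2},\qquad \sigma_{t+1}^2=\frac{(\sigma_t^2+\sigma_{D_t}^2)\sigma_{\eta_{t+1}}^2}{\sigma_t^2+\sigma_{D_t}^2+\sigma_{\eta_{t+1}}^2},\qquad s_t^2=\frac{(\sigma_t^2+\sigma_{D_t}^2)^2}{\sigma_t^2+\sigma_{D_t}^2+\sigma_{\eta_{t+1}}^2},$$ define the mean beliefs, as functions of the observed history, by $$\bar X_0=\bar x_0+\frac{\sigma_{x_0}^2}{\sigma_{x_0}^2+\sigma_{\eta_0}^2}(y_0-\bar x_0),\qquad \bar X_{t+1}=f_t(\bar X_t,a_t,y_{t+1}),$$ $$f_t(x,a,y)=m+\frac{\sigma_t^2+\sigma_{D_t}^2}{\sigma_t^2+\sigma_{D_t}^2+\sigma_{\eta_{t+1}}^2}(y-m),\qquad m=x+a-\bar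 D_t,$$ and let $h_t^*(x)=\mathsf E\,h(x+Z_t)\in[0,\infty]$ with $Z_t\sim\mathcal N(0,\sigma_{t+1}^2)$. The *mean MDP* is the fully observed inventory problem with states in $\mathbb R$, initial state distributed as $\mathcal N\big(\bar x_0,\sigma_{x_0}^4/(\sigma_{x_0}^2+\sigma_{\eta_0}^2)\big)$, transitions $\bar x_{t+1}=\bar x_t+a_t-D_t^*$ with independent $D_t^*\sim\mathcal N(\bar D_t,s_t^2)$, and one-step costs $c_t^*(x,a)=\hat c(a)+\mathsf E\,h_t^*(x+a-D_t^*)$. **Claim.** 1. Under every policy and for every $t$, the conditional distribution of $x_t$ given $h_t$ is almost surely $\mathcal N(\bar X_t,\sigma_t^2)$. The variances $\sigma_t^2$ depend neither on observations nor on actions. 2. Under every policy, $\bar X_0\sim\mathcal N\big(\bar x_0,\sigma_{x_0}^4/(\sigma_{x_0}^2+\sigma_{\eta_0}^2)\big)$ and $\bar X_{t+1}=\bar X_t+a_t-D_t^*$, where $D_t^*\sim\mathcal N(\bar D_t,s_t^2)$, the variables $D^*_0,D^*_1,\dots$ are independent, and $D_t^*$ is independent of $(h_t,a_t)$. 3.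 The map $x\mapsto\mathcal N(x,\sigma_t^2)$ at time $t$ carries the mean MDP to the belief MDP. It carries the initial distribution to the initial distribution. For all $t$, $x$, $a$, one has $H_t(\mathcal N(x,\sigma_t^2),a,y)=\mathcal N\big(f_t(x,a,y),\sigma_{t+1}^2\big)$ for almost every $y$ (with respect to the distribution of the next observation). The next belief from $\mathcal N(x,\sigma_t^2)$ under $a$ is distributed as $\mathcal N(x+a-D_t^*,\sigma_{t+1}^2)$. Finally $C_t(\mathcal N(x,\sigma_t^2),a)=c_t^*(x,a)$. 4. The belief MDP and the mean MDP are equivalent. For every policy of the belief MDP, the policy of the mean MDP that applies it to the beliefs $\mathcal N(\bar x_t,\sigma_t^2)$ defines, through this map, the same distribution of the process of beliefs and actions, and it has the same cost for all $\alpha$, $T$. The same is true for every policy of the mean MDP and the policy of the belief MDP that applies it to the means of beliefs. 5. The mean beliefs are sufficient statistics. For every policy $\pi$ of the partially observed problem there is a policy $\psi$ of the mean MDP such that $(\bar X_t,a_t)_{t\ge0}$ has under $\pi$ the same distribution as the states and actions of the mean MDP under $\psi$, and the costs of $\pi$ and $\psi$ coincide for all $\alpha$, $T$. Conversely, for every policy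 $\psi$ of the mean MDP, the policy that applies $\psi$ to the mean beliefs has these two properties. 6. For all $\alpha$, $T$ the infima of the costs over all policies in the partially observed problem, the belief MDP and the mean MDP are equal. A policy of the mean MDP is optimal if and only if its application to the mean beliefs is optimal in the partially observed problem, and if and only if its application to the means of beliefs is optimal in the belief MDP. 7. Each $h_t^*$ is convex, and if $h(x)\to\infty$ as $|x|\to\infty$, then $h_t^*(x)\to\infty$ as $|x|\to\infty$. If $c^*_t(x,0)<\infty$ for all $x$, then $h_t^*$ is finite everywhere, that is, it is a convex real-valued function. -/

import Mathlib

open MeasureTheory ProbabilityTheory Filter Topology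
open scoped NNReal ENNReal

noncomputable section

/-! ### Markov decision processes with time-dependent transition probabilities and costs -/

section Processes

variable {S S' A : Type*} [MeasurableSpace S] [MeasurableSpace S'] [MeasurableSpace A]

/-- Histories `(s₀, a₀, …, s_{t-1}, a_{t-1}, s_t)` known when the action `a_t` is selected. -/
abbrev Hist (S A : Type*) (t : ℕ) : Type _ := (Fin t → S × A) × S

/-- The history at time `t` along a trajectory `(s₀, a₀), (s₁, a₁), …`. -/
def hist (t : ℕ) (ω : ℕ → S × A) : Hist S A t := (fun i => ω i, (ω t).1)

/-- For `i < t`, the part `(s₀, a₀, …, s_i)` of a history `(s₀, a₀, …, s_t)`. -/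
def Hist.upTo {t : ℕ} (h : Hist S A t) (i : Fin t) : Hist S A i :=
  (fun j => h.1 (j.castLE i.2.le), (h.1 i).1)

/-- Replace each state `s_i` of a history by `f i (s₀, a₀, …, s_i)`; actions are unchanged. -/
def Hist.relabel (f : ∀ t, Hist S A t → S') (t : ℕ) (h : Hist S A t) : Hist S' A t :=
  (fun i => (f i (h.upTo i), (h.1 i).2), f t h)

/-- Replace each state `s_t` of a trajectory by `f t (s₀, a₀, …, s_t)`; actions are unchanged. -/
def trajRelabel (f : ∀ t, Hist S A t → S') (ω : ℕ → S × A) : ℕ → S' × A :=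
  fun t => (f t (hist t ω), (ω t).2)

theorem Hist.measurable_upTo {t : ℕ} (i : Fin t) :
    Measurable (fun h : Hist S A t => h.upTo i) := by
  unfold Hist.upTo; fun_prop

theorem Hist.measurable_relabel {f : ∀ t, Hist S A t → S'} (hf : ∀ t, Measurable (f t)) (t : ℕ) :
    Measurable (Hist.relabel f t) := by
  refine Measurable.prodMk (measurable_pi_lambda _ fun i => ?_) (hf t)
  exact ((hf i).comp (Hist.measurable_upTo i)).prodMk (by fun_prop)

/-- Randomized history-dependent policies. -/
structure Policy (S A : Type*) [MeasurableSpace S] [MeasurableSpace A] where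
  rule : ∀ t, Kernel (Hist S A t) A
  markov : ∀ t, IsMarkovKernel (rule t)

attribute [instance] Policy.markov

/-- The policy that applies `π` to the relabelled histories. -/
def Policy.comap (π : Policy S' A) (f : ∀ t, Hist S A t → S') (hf : ∀ t, Measurable (f t)) :
    Policy S A where
  rule t := (π.rule t).comap (Hist.relabel f t) (Hist.measurable_relabel hf t)
  markov _ := inferInstance

/-- A Markov decision process: initial distribution, transition probabilities, one-step costs. -/
structure MDP (S A : Type*) [MeasurableSpace S] [MeasurableSpace A] where
  init : Measure S
  trans : ℕ → Kernel (S × A) S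
  cost : ℕ → S → A → ℝ≥0∞
  init_prob : IsProbabilityMeasure init
  trans_markov : ∀ t, IsMarkovKernel (trans t)

attribute [instance] MDP.init_prob MDP.trans_markov

namespace MDP

variable (M : MDP S A) (π : Policy S A)

/-- Distribution of `(s_{n+1}, a_{n+1})` given `(s₀, a₀, …, s_n, a_n)`. -/
def step (n : ℕ) : Kernel (Finset.Iic n → S × A) (S × A) :=
  (M.trans n).comap (fun f => f ⟨n, Finset.mem_Iic.2 le_rfl⟩) (by fun_prop) ⊗ₖ
    (π.rule (n + 1)).comap
      (fun p : (Finset.Iic n → S × A) × S =>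
        ((fun i : Fin (n + 1) => p.1 ⟨i, Finset.mem_Iic.2 (Nat.lt_succ_iff.1 i.2)⟩, p.2) :
          Hist S A (n + 1)))
      (by fun_prop)

instance (n : ℕ) : IsMarkovKernel (M.step π n) := by unfold step; infer_instance

/-- Distribution of `(s₀, a₀)`. -/
def start : Measure (S × A) :=
  M.init ⊗ₘ (π.rule 0).comap (fun s => ((Fin.elim0, s) : Hist S A 0)) (by fun_prop)

instance : IsProbabilityMeasure (M.start π) := by unfold start; infer_instance

/-- The probability on trajectories `(s₀, a₀), (s₁, a₁), …` defined by the policy `π`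
(Ionescu-Tulcea). -/
def law : Measure (ℕ → S × A) :=
  ((M.start π).map (fun p (_ : Finset.Iic 0) => p)).bind
    (Kernel.traj (X := fun _ => S × A) (M.step π) 0)

instance : IsProbabilityMeasure (M.law π) := by
  have : IsProbabilityMeasure ((M.start π).map (fun p (_ : Finset.Iic 0) => p)) :=
    Measure.isProbabilityMeasure_map (by fun_prop)
  unfold law; infer_instance

/-- Expected total discounted cost over the horizon `T`, finite or infinite. -/
def value (α : ℝ≥0) (T : ℕ∞) : ℝ≥0∞ :=
  ∫⁻ ω, ∑' t : ℕ, (if (t : ℕ∞) < T then (α : ℝ≥0∞) ^ t * M.cost t (ω t).1 (ω t).2 else 0) ∂M.law π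

/-- `π` minimizes the expected total discounted cost. -/
def IsOptimal (α : ℝ≥0) (T : ℕ∞) : Prop := ∀ π', M.value π α T ≤ M.value π' α T

end MDP

end Processes

/-! ### Partially observable models and their belief MDPs -/

/-- A partially observable Markov decision process with hidden states in `X` and observations
in `Y`. At time `t` the next state has the distribution `trans t (x_t, a_t)`, and the next
observation has the distribution `obs t (a_t, x_{t+1})`. -/
structure POMDP (X Y A : Type*) [MeasurableSpace X] [MeasurableSpace Y] [MeasurableSpace A] where
  init : Measure X
  trans : ℕ → Kernel (X × A) X
  obsInit : Kernel X Y
  obs : ℕ → Kernel (A × X) Y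
  cost : ℕ → X → A → ℝ≥0∞
  init_prob : IsProbabilityMeasure init
  trans_markov : ∀ t, IsMarkovKernel (trans t)
  obsInit_markov : IsMarkovKernel obsInit
  obs_markov : ∀ t, IsMarkovKernel (obs t)

attribute [instance] POMDP.init_prob POMDP.trans_markov POMDP.obsInit_markov POMDP.obs_markov

namespace POMDP

variable {X Y A : Type*} [MeasurableSpace X] [MeasurableSpace Y] [MeasurableSpace A]
variable (M : POMDP X Y A)

/-- Joint distribution `P(· | x, a)` of the next state and observation. -/
def joint (t : ℕ) : Kernel (X × A) (X × Y) :=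
  M.trans t ⊗ₖ (M.obs t).comap (fun p : (X × A) × X => (p.1.2, p.2)) (by fun_prop)

instance (t : ℕ) : IsMarkovKernel (M.joint t) := by unfold joint; infer_instance

/-- The evolution of pairs (hidden state, observation). -/
def full : MDP (X × Y) A where
  init := M.init ⊗ₘ M.obsInit
  trans t := (M.joint t).comap (fun p : (X × Y) × A => (p.1.1, p.2)) (by fun_prop)
  cost t s a := M.cost t s.1 a
  init_prob := inferInstance
  trans_markov _ := inferInstance

/-- The observation component of the last state of a history. -/
def observe (t : ℕ) (h : Hist (X × Y) A t) : Y := h.2.2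

theorem measurable_observe (t : ℕ) : Measurable (observe (X := X) (Y := Y) (A := A) t) := by
  unfold observe; fun_prop

/-- The observed part `(y₀, a₀), (y₁, a₁), …` of a trajectory. -/
def obsTraj (ω : ℕ → (X × Y) × A) : ℕ → Y × A := trajRelabel observe ω

variable (π : Policy Y A)

/-- The probability on trajectories `((x₀, y₀), a₀), ((x₁, y₁), a₁), …` defined by a policy `π`
that selects actions on the basis of the observed histories `(y₀, a₀, …, y_t)`. -/
def law : Measure (ℕ → (X × Y) × A) := M.full.law (π.comap observe measurable_observe)

instance : IsProbabilityMeasure (M.law π) := by unfold law; infer_instance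

/-- Expected total discounted cost of a policy based on observed histories. -/
def value (α : ℝ≥0) (T : ℕ∞) : ℝ≥0∞ := M.full.value (π.comap observe measurable_observe) α T

/-- `π` is optimal among all policies based on observed histories. -/
def IsOptimal (α : ℝ≥0) (T : ℕ∞) : Prop := ∀ π', M.value π α T ≤ M.value π' α T

/-- The current state has the distribution `z`, whatever the action is. -/
def currentState (X A : Type*) [MeasurableSpace X] [MeasurableSpace A] :
    Kernel (ProbabilityMeasure X × A) X :=
  ⟨fun p => (p.1 : Measure X), measurable_subtype_coe.comp measurable_fst⟩

instance : IsMarkovKernel (currentState X A) :=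
  ⟨fun p => inferInstanceAs (IsProbabilityMeasure (p.1 : Measure X))⟩

/-- Joint distribution `R(· | z, a)` of the next observation and state, if the current state has
the distribution `z`: the mixture of `P(· | x, a)` over `z(dx)`, with coordinates swapped. -/
def beliefJoint (t : ℕ) : Kernel (ProbabilityMeasure X × A) (Y × X) :=
  (M.joint t ∘ₖ (currentState X A ×ₖ Kernel.deterministic Prod.snd measurable_snd)).map Prod.swap

instance (t : ℕ) : IsMarkovKernel (M.beliefJoint t) :=
  Kernel.IsMarkovKernel.map _ measurable_swap

/-- Joint distribution of the initial observation and the initial state. -/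
def beliefJointInit : Measure (Y × X) := (M.init ⊗ₘ M.obsInit).map Prod.swap

instance : IsProbabilityMeasure M.beliefJointInit :=
  Measure.isProbabilityMeasure_map (by fun_prop)

variable [StandardBorelSpace X] [Nonempty X]

/-- The conditional distribution of the initial state given the initial observation. -/
def filterInit (y : Y) : ProbabilityMeasure X :=
  ⟨M.beliefJointInit.condKernel y, inferInstance⟩

theorem measurable_filterInit : Measurable M.filterInit :=
  Measurable.subtype_mk (Kernel.measurable _)

variable [MeasurableSpace.CountablyGenerated Y]

/-- The filter `H(z, a, y')`: the conditional distribution of the next state given the next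
observation `y'`, if the current state has the distribution `z` and the action is `a`. -/
def filter (t : ℕ) (p : (ProbabilityMeasure X × A) × Y) : ProbabilityMeasure X :=
  ⟨(M.beliefJoint t).condKernel p, inferInstance⟩

theorem measurable_filter (t : ℕ) : Measurable (M.filter t) :=
  Measurable.subtype_mk (Kernel.measurable _)

/-- The belief MDP. From the state `z` under the action `a` the process moves to `H(z, a, y')`,
where `y'` has the marginal distribution `R'(· | z, a)`; the one-step cost is `∫ c(x, a) z(dx)`. -/
def beliefMDP : MDP (ProbabilityMeasure X) A where
  init := M.beliefJointInit.fst.map M.filterInit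
  trans t := (Kernel.id ×ₖ (M.beliefJoint t).fst).map (M.filter t)
  cost t z a := ∫⁻ x, M.cost t x a ∂(z : Measure X)
  init_prob := Measure.isProbabilityMeasure_map M.measurable_filterInit.aemeasurable
  trans_markov t := Kernel.IsMarkovKernel.map _ (M.measurable_filter t)

end POMDP

/-! ### Inventory models with backorders -/

/-- The transition probabilities `T(B | s) = μ {ξ | F (s, ξ) ∈ B}` of the stochastic equation
`s' = F (s, ξ)` with a noise `ξ` of distribution `μ`. -/
def noiseKernel {S S' : Type*} [MeasurableSpace S] [MeasurableSpace S'] (F : S × ℝ → S')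
    (μ : Measure ℝ) : Kernel S S' :=
  (Kernel.id ×ₖ Kernel.const S μ).map F

theorem isMarkovKernel_noiseKernel {S S' : Type*} [MeasurableSpace S] [MeasurableSpace S']
    {F : S × ℝ → S'} (hF : Measurable F) (μ : Measure ℝ) [IsProbabilityMeasure μ] :
    IsMarkovKernel (noiseKernel F μ) :=
  Kernel.IsMarkovKernel.map _ hF

/-- Ordering cost `K 1{a > 0} + c a`. -/
def orderCost (K c a : ℝ≥0) : ℝ≥0∞ := (if 0 < a then (K : ℝ≥0∞) else 0) + c * a

/-- The fully observed periodic-review inventory problem with backorders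
`x_{t+1} = x_t + a_t - D_t`, with independent demands `D_t` of distribution `demand t`, ordering
cost `K 1{a > 0} + c a`, and holding cost `hold t (x_{t+1})`. -/
def inventoryMDP (init : Measure ℝ) [IsProbabilityMeasure init] (demand : ℕ → Measure ℝ)
    [∀ t, IsProbabilityMeasure (demand t)] (K c : ℝ≥0) (hold : ℕ → ℝ → ℝ≥0∞) : MDP ℝ ℝ≥0 where
  init := init
  trans t := noiseKernel (fun p => p.1.1 + p.1.2 - p.2) (demand t)
  cost t x a := orderCost K c a + ∫⁻ d, hold t (x + a - d) ∂demand t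
  init_prob := inferInstance
  trans_markov _ := isMarkovKernel_noiseKernel (by fun_prop) _

/-- Data of the Gaussian inventory model with backorders and noisy observations. -/
structure GaussianInventory where
  /-- mean of the initial inventory level -/
  xMean : ℝ
  /-- variance of the initial inventory level -/
  xVar : ℝ≥0
  /-- mean of the demand at time `t` -/
  dMean : ℕ → ℝ
  /-- variance of the demand at time `t` -/
  dVar : ℕ → ℝ≥0
  /-- variance of the observation noise at time `t` -/
  nVar : ℕ → ℝ≥0
  /-- fixed ordering cost -/
  K : ℝ≥0
  /-- ordering cost per unit -/
  c : ℝ≥0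
  /-- holding cost -/
  h : ℝ → ℝ
  h_nonneg : ∀ x, 0 ≤ h x
  h_convex : ConvexOn ℝ Set.univ h

namespace GaussianInventory

variable (G : GaussianInventory)

/-- The partially observable problem `x_{t+1} = x_t + a_t - D_t`, `y_t = x_t + η_t`, with the
one-step cost `K 1{a > 0} + c a + E h(x + a - D_t)`. -/
def pomdp : POMDP ℝ ℝ ℝ≥0 where
  init := gaussianReal G.xMean G.xVar
  trans t := noiseKernel (fun p => p.1.1 + p.1.2 - p.2) (gaussianReal (G.dMean t) (G.dVar t))
  obsInit := noiseKernel (fun p => p.1 + p.2) (gaussianReal 0 (G.nVar 0))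
  obs t := noiseKernel (fun p => p.1.2 + p.2) (gaussianReal 0 (G.nVar (t + 1)))
  cost t x a := orderCost G.K G.c a +
    ∫⁻ d, ENNReal.ofReal (G.h (x + a - d)) ∂gaussianReal (G.dMean t) (G.dVar t)
  init_prob := inferInstance
  trans_markov _ := isMarkovKernel_noiseKernel (by fun_prop) _
  obsInit_markov := isMarkovKernel_noiseKernel (by fun_prop) _
  obs_markov _ := isMarkovKernel_noiseKernel (by fun_prop) _

/-- The variances `σ_t²` of posterior beliefs, with `0 / 0 = 0`. -/
def postVar : ℕ → ℝ≥0
  | 0 => G.xVar * G.nVar 0 / (G.xVar + G.nVar 0)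
  | t + 1 => (postVar t + G.dVar t) * G.nVar (t + 1) / (postVar t + G.dVar t + G.nVar (t + 1))

/-- The posterior mean at time `t + 1`, if the posterior mean at time `t` is `x`, the action at
time `t` is `a`, and `y` is observed at time `t + 1`. If the total variance in the denominator is
not zero, this is the weighted average of `x + a - dMean t` and `y` with the weights proportional
to `nVar (t + 1)` and `postVar t + dVar t`. -/
def nextMean (t : ℕ) (x : ℝ) (a : ℝ≥0) (y : ℝ) : ℝ :=
  (x + a - G.dMean t) +
    ((G.postVar t + G.dVar t) / (G.postVar t + G.dVar t + G.nVar (t + 1)) : ℝ≥0) *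
      (y - (x + a - G.dMean t))

/-- The mean beliefs as functions of observed histories `(y₀, a₀, …, y_{t-1}, a_{t-1}, y_t)`. -/
def meanBelief : ∀ t, Hist ℝ ℝ≥0 t → ℝ
  | 0, h => G.xMean + (G.xVar / (G.xVar + G.nVar 0) : ℝ≥0) * (h.2 - G.xMean)
  | t + 1, h => G.nextMean t (meanBelief t (h.upTo (Fin.last t))) (h.1 (Fin.last t)).2 h.2

theorem measurable_meanBelief : ∀ t, Measurable (G.meanBelief t)
  | 0 => by
    change Measurable fun h : Hist ℝ ℝ≥0 0 =>
      G.xMean + (G.xVar / (G.xVar + G.nVar 0) : ℝ≥0) * (h.2 - G.xMean)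
    fun_prop
  | t + 1 => by
    have h1 : Measurable fun h : Hist ℝ ℝ≥0 (t + 1) => G.meanBelief t (h.upTo (Fin.last t)) :=
      (measurable_meanBelief t).comp (Hist.measurable_upTo (Fin.last t))
    change Measurable fun h : Hist ℝ ℝ≥0 (t + 1) =>
      G.nextMean t (G.meanBelief t (h.upTo (Fin.last t))) (h.1 (Fin.last t)).2 h.2
    unfold nextMean
    fun_prop

/-- The variances of the demands `D*_t`, with `0 / 0 = 0`. -/
def starVar (t : ℕ) : ℝ≥0 :=
  (G.postVar t + G.dVar t) ^ 2 / (G.postVar t + G.dVar t + G.nVar (t + 1))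

/-- The holding costs `h*_t(x) = E h(x + Z_t)`, where `Z_t` is normal with mean `0` and
variance `σ_{t+1}²`. -/
def starHold (t : ℕ) (x : ℝ) : ℝ≥0∞ :=
  ∫⁻ z, ENNReal.ofReal (G.h (x + z)) ∂gaussianReal 0 (G.postVar (t + 1))

/-- The fully observed inventory problem for mean beliefs. -/
def meanMDP : MDP ℝ ℝ≥0 :=
  inventoryMDP (gaussianReal G.xMean (G.xVar ^ 2 / (G.xVar + G.nVar 0)))
    (fun t => gaussianReal (G.dMean t) (G.starVar t)) G.K G.c G.starHold

/-- The belief at time `t` with mean `x`, that is, the normal distribution with mean `x` and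
variance `σ_t²`. -/
def normalBelief (t : ℕ) (x : ℝ) : ProbabilityMeasure ℝ :=
  ⟨gaussianReal x (G.postVar t), inferInstance⟩

/-- `normalBelief` applied to the last state of a history of mean beliefs. -/
def toBelief (t : ℕ) (h : Hist ℝ ℝ≥0 t) : ProbabilityMeasure ℝ := G.normalBelief t h.2

theorem measurable_toBelief (t : ℕ) : Measurable (G.toBelief t) :=
  Measurable.subtype_mk
    (measurable_gaussianReal.comp (measurable_snd.prodMk measurable_const))

/-- The mean of the last belief of a history of beliefs. -/
def toMean (t : ℕ) (h : Hist (ProbabilityMeasure ℝ) ℝ≥0 t) : ℝ := ∫ x, x ∂(h.2 : Measure ℝ)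

theorem measurable_toMean (t : ℕ) : Measurable (toMean t) := by
  have h := (stronglyMeasurable_id (α := ℝ)).integral_kernel
    (κ := (⟨fun z : ProbabilityMeasure ℝ => (z : Measure ℝ), measurable_subtype_coe⟩ :
      Kernel (ProbabilityMeasure ℝ) ℝ))
  exact h.measurable.comp measurable_snd

/-- The mean beliefs along a trajectory of the partially observable problem. -/
def beliefTraj (ω : ℕ → (ℝ × ℝ) × ℝ≥0) : ℕ → ℝ × ℝ≥0 :=
  trajRelabel G.meanBelief (POMDP.obsTraj ω)

/-- The random variables `D*_t = x̄_t + a_t - x̄_{t+1}`, where `x̄_t` are mean beliefs. -/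
def starDemand (t : ℕ) (ω : ℕ → (ℝ × ℝ) × ℝ≥0) : ℝ :=
  (G.beliefTraj ω t).1 + (G.beliefTraj ω t).2 - (G.beliefTraj ω (t + 1)).1

end GaussianInventory

end

/-! Everything rests on normal regression. Let `x` and `e` be independent normal with variances `V`
and `N`, let `y = x + e`, and let `k = V / (V + N)`. The residual `x - k y` is uncorrelated with
`y`, hence independent of it by joint normality (`gaussianReal_prod_map_regression`). So `x` given
`y` is normal, with a mean affine in `y` and the variance `V N / (V + N)`, which does not involve
`y`. By induction on time the posteriors stay normal with deterministic variances
(`hasCondDistrib_posterior`), and a belief is determined by its mean. The next mean, affine in the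
next observation, is normal around `x + a - dMean t` with variance `starVar t`. Hence, given the
observed past and the action, the law of `D*_t` is constant, which yields all the independence
claims.

Costs agree by the decomposition of variance `starVar_add_postVar`: both one-step costs integrate
`h` against the same normal law (`lintegral_pomdp_cost`).

Laws of processes are compared by uniqueness (`MDP.IsLaw.eq_law`): a law on trajectories is
determined by its initial distribution, action rules and transition probabilities, so an image
process is identified by checking these three. An arbitrary policy `π` is matched with the
conditional distributions of its actions given the past of the mean beliefs. The statements on
infima and optimality are then formal.

For `h*_t`, convexity passes through the integral, and Jensen's inequality gives `h ≤ h*_t`, hence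
coercivity. The same inequality for `h*_t` gives its finiteness. -/

noncomputable section

/-! ### Conditional distributions -/

namespace ProbabilityTheory

variable {Ω Ω' X Y Z : Type*} [MeasurableSpace Ω] [MeasurableSpace Ω'] [MeasurableSpace X]
  [MeasurableSpace Y] [MeasurableSpace Z] {P : Measure Ω}

theorem Kernel.compProd_prodMkRight (κ : Kernel X Y) [IsMarkovKernel κ] (η : Kernel X Z)
    [IsMarkovKernel η] : κ ⊗ₖ η.prodMkRight Y = κ ×ₖ η := by
  ext x s hs
  rw [Kernel.compProd_apply hs, Kernel.prod_apply, Measure.prod_apply hs]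
  rfl

theorem Kernel.map_swap_prod (κ : Kernel X Y) [IsMarkovKernel κ] (η : Kernel X Z)
    [IsMarkovKernel η] : (κ ×ₖ η).map Prod.swap = η ×ₖ κ := by
  ext1 x
  rw [Kernel.map_apply _ measurable_swap, Kernel.prod_apply, Kernel.prod_apply, Measure.prod_swap]

/-- A change of variable in each fibre. With a constant `κ` it realizes the kernel `η` through a
noise independent of `x`. -/
theorem compProd_map_prodMk {μ : Measure X} [SFinite μ] {κ : Kernel X Y} [IsSFiniteKernel κ]
    {η : Kernel X Z} [IsSFiniteKernel η] {g : X → Y → Z} (hg : Measurable (Function.uncurry g))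
    (h : ∀ x, (κ x).map (g x) = η x) :
    (μ ⊗ₘ κ).map (fun p => (p.1, g p.1 p.2)) = μ ⊗ₘ η := by
  have hgg : Measurable fun p : X × Y => (p.1, g p.1 p.2) := measurable_fst.prodMk hg
  ext s hs
  rw [Measure.map_apply hgg hs, Measure.compProd_apply (hgg hs), Measure.compProd_apply hs]
  refine lintegral_congr fun x => ?_
  have hgx : Measurable (g x) := hg.comp measurable_prodMk_left
  rw [← h x, Measure.map_apply hgx (measurable_prodMk_left hs)]
  rfl

theorem HasCondDistrib.prodMk [SFinite P] {U : Ω → X} {V : Ω → Y} {W : Ω → Z} {κ : Kernel X Y}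
    [IsMarkovKernel κ] {η : Kernel (X × Y) Z} [IsMarkovKernel η] (hV : HasCondDistrib V U κ P)
    (hW : HasCondDistrib W (fun ω => (U ω, V ω)) η P) :
    HasCondDistrib (fun ω => (V ω, W ω)) U (κ ⊗ₖ η) P := by
  have hU := hV.aemeasurable_fst
  have hV' := hV.aemeasurable_snd
  have hW' := hW.aemeasurable_snd
  refine ⟨by fun_prop, ?_⟩
  rw [← Measure.compProd_assoc', ← hV.map_eq, ← hW.map_eq,
    AEMeasurable.map_map_of_aemeasurable (by fun_prop) (by fun_prop)]
  rfl

/-- If `W` depends on `(U, V)` only through `U`, then `V` depends on `(U, W)` only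
through `U`. -/
theorem HasCondDistrib.swap [SFinite P] {U : Ω → X} {V : Ω → Y} {W : Ω → Z} {κ : Kernel X Y}
    [IsMarkovKernel κ] {η : Kernel X Z} [IsMarkovKernel η] (hV : HasCondDistrib V U κ P)
    (hW : HasCondDistrib W (fun ω => (U ω, V ω)) (η.prodMkRight Y) P) :
    HasCondDistrib V (fun ω => (U ω, W ω)) (κ.prodMkRight Z) P := by
  -- Given `U`, the pair `(V, W)` has a product law. The swapped pair then has the swapped product
  -- law, which is disintegrated in the other order.
  refine HasCondDistrib.of_compProd (κ := η) ?_
  have h := (hV.prodMk hW).comp_left measurable_swap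
  rw [Kernel.compProd_prodMkRight, Kernel.map_swap_prod] at h
  rwa [Kernel.compProd_prodMkRight]

theorem HasCondDistrib.comp_prod [SFinite P] {U : Ω → X} {V : Ω → Y} {κ : Kernel X Y}
    [IsMarkovKernel κ] {η : Kernel X Z} [IsMarkovKernel η] (hV : HasCondDistrib V U κ P)
    {g : X → Y → Z} (hg : Measurable (Function.uncurry g)) (h : ∀ x, (κ x).map (g x) = η x) :
    HasCondDistrib (fun ω => g (U ω) (V ω)) U η P := by
  have hU := hV.aemeasurable_fst
  have hV' := hV.aemeasurable_snd
  have hgg : Measurable fun p : X × Y => (p.1, g p.1 p.2) := measurable_fst.prodMk hg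
  refine ⟨hgg.comp_aemeasurable (hU.prodMk hV'), ?_⟩
  change P.map ((fun p : X × Y => (p.1, g p.1 p.2)) ∘ fun ω => (U ω, V ω)) = _
  rw [← AEMeasurable.map_map_of_aemeasurable hgg.aemeasurable (by fun_prop), hV.map_eq,
    compProd_map_prodMk hg h]

theorem HasCondDistrib.of_map {μ : Measure Ω} {g : Ω → Ω'} (hg : Measurable g) {U : Ω' → X}
    {V : Ω' → Y} (hU : Measurable U) (hV : Measurable V) {κ : Kernel X Y}
    (h : HasCondDistrib (fun ω => V (g ω)) (fun ω => U (g ω)) κ μ) :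
    HasCondDistrib V U κ (μ.map g) := by
  refine ⟨by fun_prop, ?_⟩
  rw [Measure.map_map hU hg, Measure.map_map (by fun_prop) hg]
  exact h.map_eq

theorem HasCondDistrib.indepFun [IsProbabilityMeasure P] {U : Ω → X} {V : Ω → Y} {ν : Measure Y}
    [IsProbabilityMeasure ν] (h : HasCondDistrib V U (Kernel.const X ν) P) : IndepFun U V P := by
  have := Measure.isProbabilityMeasure_map h.aemeasurable_fst
  rw [indepFun_iff_map_prod_eq_prod_map_map h.aemeasurable_fst h.aemeasurable_snd, h.map_eq,
    Measure.compProd_const, h.hasLaw_of_const.map_eq]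

theorem HasCondDistrib.lintegral [SFinite P] {U : Ω → X} {V : Ω → Y} {κ : Kernel X Y}
    [IsMarkovKernel κ] (h : HasCondDistrib V U κ P) {f : X → Y → ℝ≥0∞}
    (hf : Measurable (Function.uncurry f)) :
    ∫⁻ ω, f (U ω) (V ω) ∂P = ∫⁻ ω, ∫⁻ y, f (U ω) y ∂κ (U ω) ∂P := by
  have h1 : ∫⁻ ω, f (U ω) (V ω) ∂P = ∫⁻ p, Function.uncurry f p ∂P.map fun ω => (U ω, V ω) := by
    rw [lintegral_map' hf.aemeasurable h.aemeasurable]; rfl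
  rw [h1, h.map_eq, Measure.lintegral_compProd hf, lintegral_map' ?_ h.aemeasurable_fst]
  · rfl
  · exact hf.lintegral_kernel_prod_right.aemeasurable

/-- Random variables are independent if each of them is independent of a statistic that
determines the preceding ones. -/
theorem iIndepFun_of_indepFun_past [Nonempty Y] [IsProbabilityMeasure P] {D : ℕ → Ω → Y}
    {E : ℕ → Type*} [∀ t, MeasurableSpace (E t)]
    {U : ∀ t, Ω → E t} (hU : ∀ s t, s < t → ∃ g : E t → Y, Measurable g ∧ ∀ ω, D s ω = g (U t ω))
    (h : ∀ t, IndepFun (U t) (D t) P) : iIndepFun D P := by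
  rw [iIndepFun_iff_measure_inter_preimage_eq_mul]
  intro S
  -- The largest index is split off: an event about the earlier variables is a preimage under `U t`,
  -- which is independent of `D t`.
  induction S using Finset.induction_on_max with
  | empty => simp
  | insert t S ht ih =>
    intro B hB
    have htS : t ∉ S := fun h => lt_irrefl _ (ht t h)
    rw [Finset.set_biInter_insert, Finset.prod_insert htS, Set.inter_comm, mul_comm,
      ← ih fun i hi => hB i (Finset.mem_insert_of_mem hi)]
    choose! g hg hgD using fun s (hs : s ∈ S) => hU s t (ht s hs)
    have hset : (⋂ i ∈ S, D i ⁻¹' B i) = U t ⁻¹' ⋂ i ∈ S, g i ⁻¹' B i := by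
      ext ω
      simp only [Set.mem_iInter, Set.mem_preimage]
      exact forall₂_congr fun i hi => by rw [hgD i hi]
    rw [hset]
    refine (h t).measure_inter_preimage_eq_mul _ _ ?_ (hB t (Finset.mem_insert_self _ _))
    exact Finset.measurableSet_biInter _ fun i hi =>
      hg i hi (hB i (Finset.mem_insert_of_mem hi))

end ProbabilityTheory

/-! ### Characterization of the laws of trajectories -/

section Laws

variable {S S' A : Type*} [MeasurableSpace S] [MeasurableSpace S'] [MeasurableSpace A]

@[fun_prop]
theorem measurable_hist (t : ℕ) : Measurable (hist t : (ℕ → S × A) → Hist S A t) := by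
  unfold hist; fun_prop

theorem measurable_trajRelabel {f : ∀ t, Hist S A t → S'} (hf : ∀ t, Measurable (f t)) :
    Measurable (trajRelabel f) :=
  measurable_pi_lambda _ fun t => ((hf t).comp (measurable_hist t)).prodMk (by fun_prop)

/-- The history `(s₀, a₀, …, s_{t+1})` composed of `(s₀, a₀, …, s_t, a_t)` and `s_{t+1}`. -/
def Hist.snoc {t : ℕ} (p : (Hist S A t × A) × S) : Hist S A (t + 1) :=
  (Fin.snoc (α := fun _ => S × A) p.1.1.1 (p.1.1.2, p.1.2), p.2)

theorem Hist.measurable_snoc {t : ℕ} :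
    Measurable (Hist.snoc : (Hist S A t × A) × S → Hist S A (t + 1)) := by
  refine Measurable.prodMk (measurable_pi_lambda _ fun i => ?_) measurable_snd
  refine Fin.lastCases ?_ (fun j => ?_) i
  · simp only [Fin.snoc_last]; fun_prop
  · simp only [Fin.snoc_castSucc]; fun_prop

theorem hist_succ {S A : Type*} (t : ℕ) (ω : ℕ → S × A) :
    hist (t + 1) ω = Hist.snoc ((hist t ω, (ω t).2), (ω (t + 1)).1) := by
  refine Prod.ext (funext fun i => ?_) rfl
  refine Fin.lastCases ?_ (fun j => ?_) i
  · simp [hist, Hist.snoc]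
  · simp [hist, Hist.snoc]

namespace MDP

/-- A probability on trajectories with the initial distribution and the transition probabilities
of `M`, and with actions selected by `π`. -/
structure IsLaw (M : MDP S A) (π : Policy S A) (μ : Measure (ℕ → S × A)) : Prop where
  init : μ.map (fun ω => (ω 0).1) = M.init
  action : ∀ t, HasCondDistrib (fun ω => (ω t).2) (hist t) (π.rule t) μ
  trans : ∀ t, HasCondDistrib (fun ω => (ω (t + 1)).1) (fun ω => (hist t ω, (ω t).2))
    ((M.trans t).comap (fun p : Hist S A t × A => (p.1.2, p.2)) (by fun_prop)) μ

variable {M : MDP S A} {π : Policy S A}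

theorem law_eq_trajMeasure (M : MDP S A) (π : Policy S A) :
    M.law π = Kernel.trajMeasure (X := fun _ => S × A) (M.start π) (M.step π) := rfl

theorem map_eval_zero_law (M : MDP S A) (π : Policy S A) :
    (M.law π).map (fun ω => ω 0) = M.start π := by
  have h : (M.law π).map (Preorder.frestrictLe (π := fun _ => S × A) 0) =
      (M.start π).map (fun p (_ : Finset.Iic 0) => p) := by
    unfold law
    rw [Measure.map_comp _ _ (by fun_prop), Kernel.traj_map_frestrictLe, Kernel.partialTraj_self,
      Measure.id_comp]
  have h2 := congrArg (Measure.map fun f : Finset.Iic 0 → S × A =>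
    f ⟨0, Finset.mem_Iic.2 le_rfl⟩) h
  rw [Measure.map_map (by fun_prop) (by fun_prop), Measure.map_map (by fun_prop) (by fun_prop)]
    at h2
  exact h2.trans Measure.map_id

/-- The Ionescu-Tulcea construction yields state and action as one pair. The first marginal of the
step kernel gives the transition, its second factor the action rule. -/
theorem isLaw_law (M : MDP S A) (π : Policy S A) : M.IsLaw π (M.law π) := by
  have hstep (n : ℕ) : HasCondDistrib (fun ω : ℕ → S × A => ((ω (n + 1)).1, (ω (n + 1)).2))
      (Preorder.frestrictLe (π := fun _ => S × A) n) (M.step π n) (M.law π) := by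
    refine ⟨by fun_prop, ?_⟩
    rw [law_eq_trajMeasure]
    exact Kernel.map_frestrictLe_trajMeasure_compProd_eq_map_trajMeasure.symm
  refine ⟨?_, ?_, fun t => ?_⟩
  · have h := congrArg Measure.fst (map_eval_zero_law M π)
    rw [start, Measure.fst_compProd, Measure.fst, Measure.map_map (by fun_prop) (by fun_prop)] at h
    exact h
  · rintro (_ | t)
    · have h : HasCondDistrib (fun ω : ℕ → S × A => (ω 0).2) (fun ω => (ω 0).1)
          ((π.rule 0).comap (fun s => ((Fin.elim0, s) : Hist S A 0)) (by fun_prop)) (M.law π) := by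
        refine ⟨by fun_prop, ?_⟩
        have h := congrArg Measure.fst (map_eval_zero_law M π)
        rw [start, Measure.fst_compProd, Measure.fst,
          Measure.map_map (by fun_prop) (by fun_prop)] at h
        refine (map_eval_zero_law M π).trans ?_
        rw [start, ← h]
        rfl
      have h2 := h.comp_right
      convert h2 using 1
      funext ω
      exact Prod.ext (Subsingleton.elim _ _) rfl
    · have h := (hstep t).of_compProd
      exact h.comp_right
  · have h := (hstep t).fst
    rw [step, Kernel.fst_compProd] at h
    exact HasCondDistrib.comp_right (κ := (M.trans t).comap
      (fun p : Hist S A t × A => (p.1.2, p.2)) (by fun_prop)) (f := fun p : Finset.Iic t → S × A =>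
      (((fun i : Fin t => p ⟨i, Finset.mem_Iic.2 i.2.le⟩, (p ⟨t, Finset.mem_Iic.2 le_rfl⟩).1),
        (p ⟨t, Finset.mem_Iic.2 le_rfl⟩).2) : Hist S A t × A)) (hf := by fun_prop) h

/-- Induction in half-steps: the action rule extends the law of a history by `a_t`, and the
transition probability extends the result by `s_{t+1}`. -/
theorem IsLaw.map_hist_eq {μ ν : Measure (ℕ → S × A)} (hμ : M.IsLaw π μ) (hν : M.IsLaw π ν)
    (t : ℕ) : μ.map (fun ω => (hist t ω, (ω t).2)) = ν.map (fun ω => (hist t ω, (ω t).2)) := by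
  have key (t : ℕ) (h : μ.map (hist t) = ν.map (hist t)) :
      μ.map (fun ω => (hist t ω, (ω t).2)) = ν.map (fun ω => (hist t ω, (ω t).2)) := by
    rw [(hμ.action t).map_eq, (hν.action t).map_eq, h]
  refine key t ?_
  induction t with
  | zero =>
    have h0 : (hist 0 : (ℕ → S × A) → Hist S A 0) =
        (fun s => (Fin.elim0, s)) ∘ fun ω => (ω 0).1 := by
      funext ω
      exact Prod.ext (Subsingleton.elim _ _) rfl
    rw [h0, ← Measure.map_map (by fun_prop) (by fun_prop),
      ← Measure.map_map (by fun_prop) (by fun_prop), hμ.init, hν.init]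
  | succ t ih =>
    have h1 : (hist (t + 1) : (ℕ → S × A) → Hist S A (t + 1)) =
        Hist.snoc ∘ fun ω => ((hist t ω, (ω t).2), (ω (t + 1)).1) := funext (hist_succ t)
    rw [h1, ← Measure.map_map Hist.measurable_snoc (by fun_prop),
      ← Measure.map_map Hist.measurable_snoc (by fun_prop), (hμ.trans t).map_eq,
      (hν.trans t).map_eq, key t ih]

/-- Both measures are projective limits of the same finite-dimensional marginals. -/
theorem IsLaw.eq_law {μ : Measure (ℕ → S × A)} (hμ : M.IsLaw π μ) : μ = M.law π := by
  have : IsProbabilityMeasure μ := by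
    refine ⟨?_⟩
    have h := congrArg (fun ν => ν Set.univ) hμ.init
    simp only [measure_univ] at h
    rwa [Measure.map_apply (by fun_prop) MeasurableSet.univ] at h
  have hfr (n : ℕ) : μ.map (Preorder.frestrictLe (π := fun _ => S × A) n) =
      (M.law π).map (Preorder.frestrictLe n) := by
    -- `g` rebuilds the coordinates up to `n` from the history and the last action.
    let g : Hist S A n × A → (Finset.Iic n → S × A) := fun p i =>
      if h : (i : ℕ) < n then p.1.1 ⟨i, h⟩ else (p.1.2, p.2)
    have hg : Measurable g := by
      refine measurable_pi_lambda _ fun i => ?_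
      by_cases h : (i : ℕ) < n
      · simp only [g, dif_pos h]; fun_prop
      · simp only [g, dif_neg h]; fun_prop
    have h1 : Preorder.frestrictLe (π := fun _ => S × A) n =
        g ∘ fun ω => (hist n ω, (ω n).2) := by
      funext ω i
      by_cases h : (i : ℕ) < n
      · simp [g, h, hist]
      · have hi : (i : ℕ) = n := le_antisymm (Finset.mem_Iic.1 i.2) (not_lt.1 h)
        simp [g, hist, hi]
    rw [h1, ← Measure.map_map hg (by fun_prop), ← Measure.map_map hg (by fun_prop),
      hμ.map_hist_eq (isLaw_law M π)]
  have hfam : IsProjectiveMeasureFamily (α := fun _ : ℕ => S × A)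
      (fun I : Finset ℕ => (M.law π).map (I.restrict (π := fun _ => S × A))) := by
    intro I J hJI
    exact (Measure.map_map (Finset.measurable_restrict₂ (X := fun _ : ℕ => S × A) hJI)
      (Finset.measurable_restrict (X := fun _ : ℕ => S × A) I)).symm
  have h1 : IsProjectiveLimit μ
      (fun I : Finset ℕ => (M.law π).map (I.restrict (π := fun _ => S × A))) :=
    (isProjectiveLimit_nat_iff hfam μ).2 hfr
  have h2 : IsProjectiveLimit (M.law π)
      (fun I : Finset ℕ => (M.law π).map (I.restrict (π := fun _ => S × A))) := fun _ => rfl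
  exact h1.unique h2

/-- A process `T` with the initial distribution, the transition probabilities and the actions of
`M` under `π` has the law `M.law π`. -/
theorem map_eq_law {Ω : Type*} [MeasurableSpace Ω] {μ : Measure Ω} {T : Ω → ℕ → S × A}
    (hT : Measurable T) (h0 : μ.map (fun ω => (T ω 0).1) = M.init)
    (hact : ∀ t, HasCondDistrib (fun ω => (T ω t).2) (fun ω => hist t (T ω)) (π.rule t) μ)
    (htr : ∀ t, HasCondDistrib (fun ω => (T ω (t + 1)).1) (fun ω => (hist t (T ω), (T ω t).2))
      ((M.trans t).comap (fun p : Hist S A t × A => (p.1.2, p.2)) (by fun_prop)) μ) :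
    μ.map T = M.law π := by
  refine IsLaw.eq_law ⟨?_, fun t => ?_, fun t => ?_⟩
  · rw [Measure.map_map (by fun_prop) hT]; exact h0
  · exact (hact t).of_map hT (by fun_prop) (by fun_prop)
  · exact (htr t).of_map hT (U := fun ω => (hist t ω, (ω t).2)) (V := fun ω => (ω (t + 1)).1)
      (by fun_prop) (by fun_prop)

/-- Costs are nonnegative, so sum and integral commute. Comparing values thus reduces to comparing
expected costs at each time. -/
theorem value_eq_tsum (hM : ∀ t, Measurable (Function.uncurry (M.cost t))) (α : ℝ≥0) (T : ℕ∞) :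
    M.value π α T = ∑' t : ℕ, if (t : ℕ∞) < T then
      (α : ℝ≥0∞) ^ t * ∫⁻ ω, M.cost t (ω t).1 (ω t).2 ∂M.law π else 0 := by
  have hm (t : ℕ) : Measurable fun ω : ℕ → S × A => M.cost t (ω t).1 (ω t).2 :=
    (hM t).comp (measurable_pi_apply t)
  unfold value
  rw [lintegral_tsum fun t => ?_]
  · refine tsum_congr fun t => ?_
    split_ifs
    · exact lintegral_const_mul _ (hm t)
    · simp
  · split_ifs
    · exact ((hm t).const_mul _).aemeasurable
    · exact aemeasurable_const

end MDP

end Laws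

/-! ### Normal distributions and observations with additive normal noise -/

section Gaussian

theorem noiseKernel_apply {S S' : Type*} [MeasurableSpace S] [MeasurableSpace S']
    {F : S × ℝ → S'} (hF : Measurable F) (μ : Measure ℝ) [SFinite μ] (s : S) :
    noiseKernel F μ s = μ.map fun ξ => F (s, ξ) := by
  rw [noiseKernel, Kernel.map_apply _ hF, Kernel.prod_apply, Kernel.id_apply, Kernel.const_apply,
    Measure.dirac_prod, Measure.map_map hF (by fun_prop)]
  rfl

/-- The normal distribution with mean `f a` and variance `v`. -/
def gaussianKernel {α : Type*} [MeasurableSpace α] (f : α → ℝ) (hf : Measurable f) (v : ℝ≥0) :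
    Kernel α ℝ :=
  ⟨fun a => gaussianReal (f a) v, measurable_gaussianReal.comp (hf.prodMk measurable_const)⟩

theorem gaussianKernel_apply {α : Type*} [MeasurableSpace α] {f : α → ℝ} (hf : Measurable f)
    (v : ℝ≥0) (a : α) : gaussianKernel f hf v a = gaussianReal (f a) v := rfl

instance {α : Type*} [MeasurableSpace α] (f : α → ℝ) (hf : Measurable f) (v : ℝ≥0) :
    IsMarkovKernel (gaussianKernel f hf v) :=
  ⟨fun a => inferInstanceAs (IsProbabilityMeasure (gaussianReal (f a) v))⟩

theorem gaussianReal_map_affine (m : ℝ) (v : ℝ≥0) (b c : ℝ) (w : ℝ≥0) (hw : (w : ℝ) = c ^ 2 * v) :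
    (gaussianReal m v).map (fun x => b + c * x) = gaussianReal (b + c * m) w := by
  have h : (fun x : ℝ => b + c * x) = (fun x => b + x) ∘ fun x => c * x := rfl
  rw [h, ← Measure.map_map (by fun_prop) (by fun_prop), gaussianReal_map_const_mul,
    gaussianReal_map_const_add, add_comm]
  congr 1
  exact NNReal.coe_injective (by simp [hw])

theorem gaussianReal_prod_map_add (m₁ m₂ : ℝ) (v₁ v₂ : ℝ≥0) :
    ((gaussianReal m₁ v₁).prod (gaussianReal m₂ v₂)).map (fun p => p.1 + p.2) =
      gaussianReal (m₁ + m₂) (v₁ + v₂) :=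
  gaussianReal_conv_gaussianReal

/-- The residual of the regression of `x` on `x + e`, with independent normal `x` and `e`, does
not depend on `x + e`. -/
theorem gaussianReal_prod_map_regression (m : ℝ) (V N : ℝ≥0) (k : ℝ) (W : ℝ≥0)
    (hk : (1 - k) * V = k * N) (hW : (W : ℝ) = k * N) :
    ((gaussianReal m V).prod (gaussianReal 0 N)).map
        (fun p => (p.1 + p.2, (1 - k) * p.1 - k * p.2)) =
      (gaussianReal m (V + N)).prod (gaussianReal ((1 - k) * m) W) := by
  set P := (gaussianReal m V).prod (gaussianReal 0 N) with hP
  have h1 : P.map Prod.fst = gaussianReal m V := by simp [hP]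
  have h2 : P.map Prod.snd = gaussianReal 0 N := by simp [hP]
  have hind : IndepFun (Prod.fst : ℝ × ℝ → ℝ) Prod.snd P := by
    rw [indepFun_iff_map_prod_eq_prod_map_map (by fun_prop) (by fun_prop), h1, h2]
    exact Measure.map_id
  have g1 : HasGaussianLaw (Prod.fst : ℝ × ℝ → ℝ) P := ⟨by rw [h1]; infer_instance⟩
  have g2 : HasGaussianLaw (Prod.snd : ℝ × ℝ → ℝ) P := ⟨by rw [h2]; infer_instance⟩
  have g12 : HasGaussianLaw (fun p : ℝ × ℝ => (p.1, p.2)) P := hind.hasGaussianLaw g1 g2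
  let L : ℝ × ℝ →L[ℝ] ℝ × ℝ :=
    (ContinuousLinearMap.fst ℝ ℝ ℝ + ContinuousLinearMap.snd ℝ ℝ ℝ).prod
      ((1 - k) • ContinuousLinearMap.fst ℝ ℝ ℝ - k • ContinuousLinearMap.snd ℝ ℝ ℝ)
  have g : HasGaussianLaw (fun p : ℝ × ℝ => (p.1 + p.2, (1 - k) * p.1 - k * p.2)) P := by
    simpa [L] using g12.map_fun L
  have m1 : MemLp (fun p : ℝ × ℝ => p.1) 2 P := g1.memLp_two
  have m2 : MemLp (fun p : ℝ × ℝ => p.2) 2 P := g2.memLp_two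
  have m12 : MemLp (fun p : ℝ × ℝ => p.1 + p.2) 2 P := m1.add m2
  have v1 : Var[fun p : ℝ × ℝ => p.1; P] = V := by
    have := variance_map (X := fun x : ℝ => x) (μ := P) (Y := Prod.fst) (by fun_prop) (by fun_prop)
    rw [h1, variance_fun_id_gaussianReal] at this
    exact this.symm
  have v2 : Var[fun p : ℝ × ℝ => p.2; P] = N := by
    have := variance_map (X := fun x : ℝ => x) (μ := P) (Y := Prod.snd) (by fun_prop) (by fun_prop)
    rw [h2, variance_fun_id_gaussianReal] at this
    exact this.symm
  have c12 : cov[fun p : ℝ × ℝ => p.1, fun p : ℝ × ℝ => p.2; P] = 0 :=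
    hind.covariance_eq_zero m1 m2
  have hadd (f : ℝ × ℝ → ℝ) (hf : MemLp f 2 P) :
      cov[fun p : ℝ × ℝ => p.1 + p.2, f; P] =
        cov[fun p : ℝ × ℝ => p.1, f; P] + cov[fun p : ℝ × ℝ => p.2, f; P] :=
    covariance_add_left m1 m2 hf
  -- The covariance is `(1 - k) V - k N`, which `hk` makes zero; joint normality then gives
  -- independence.
  have hcov : cov[fun p : ℝ × ℝ => p.1 + p.2, fun p : ℝ × ℝ => (1 - k) * p.1 - k * p.2; P] = 0 := by
    rw [covariance_fun_sub_right m12 (m1.const_mul _) (m2.const_mul _),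
      covariance_const_mul_right, covariance_const_mul_right, hadd _ m1, hadd _ m2,
      covariance_comm (fun p : ℝ × ℝ => p.2), c12, covariance_self (by fun_prop), covariance_self (by fun_prop), v1, v2]
    linarith
  have hi := g.indepFun_of_covariance_eq_zero hcov
  rw [(indepFun_iff_map_prod_eq_prod_map_map (by fun_prop) (by fun_prop)).1 hi,
    gaussianReal_prod_map_add, add_zero]
  congr 1
  have e1 : P.map (fun p => (1 - k) * p.1) =
      gaussianReal ((1 - k) * m) (.mk ((1 - k) ^ 2) (sq_nonneg _) * V) := by
    rw [← gaussianReal_map_const_mul, ← h1, Measure.map_map (by fun_prop) (by fun_prop)]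
    rfl
  have e2 : P.map (fun p => -k * p.2) =
      gaussianReal (-k * 0) (.mk ((-k) ^ 2) (sq_nonneg _) * N) := by
    rw [← gaussianReal_map_const_mul, ← h2, Measure.map_map (by fun_prop) (by fun_prop)]
    rfl
  have h3 := gaussianReal_add_gaussianReal_of_indepFun
    (hind.comp (φ := fun x => (1 - k) * x) (ψ := fun x => -k * x) (by fun_prop) (by fun_prop)) e1 e2
  have h4 : (fun p : ℝ × ℝ => (1 - k) * p.1 - k * p.2) =
      ((fun x => (1 - k) * x) ∘ Prod.fst) + ((fun x => -k * x) ∘ Prod.snd) := by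
    funext p
    simp [sub_eq_add_neg]
  rw [h4, h3, mul_zero, add_zero]
  congr 1
  refine NNReal.coe_injective ?_
  simp only [NNReal.coe_add, NNReal.coe_mul, NNReal.coe_mk, hW]
  -- The residual variance `(1 - k)² V + k² N` reduces to `k N` through `(1 - k) V = k N`.
  linear_combination (1 - k) * hk

/-- This is the orthogonality condition of the regression. If `V = N = 0`, both sides vanish, so the
convention `0 / 0 = 0` is harmless. -/
theorem one_sub_gain_mul (V N : ℝ≥0) :
    (1 - ((V / (V + N) : ℝ≥0) : ℝ)) * V = ((V / (V + N) : ℝ≥0) : ℝ) * N := by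
  rcases eq_or_ne (V + N) 0 with h | h
  · obtain ⟨rfl, rfl⟩ := add_eq_zero.1 h
    simp
  · have h' : (V : ℝ) + N ≠ 0 := by exact_mod_cast h
    push_cast
    field_simp
    ring

/-- The joint distribution of the observation `y = x + e` and the state `x`, if `x` and `e` are
independent and normal. -/
theorem map_swap_compProd_noiseKernel (m : ℝ) (V N : ℝ≥0) :
    (gaussianReal m V ⊗ₘ noiseKernel (fun p : ℝ × ℝ => p.1 + p.2) (gaussianReal 0 N)).map
        Prod.swap =
      gaussianReal m (V + N) ⊗ₘ gaussianKernel
        (fun y => m + ((V / (V + N) : ℝ≥0) : ℝ) * (y - m)) (by fun_prop) (V * N / (V + N)) := by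
  have : IsMarkovKernel (noiseKernel (fun p : ℝ × ℝ => p.1 + p.2) (gaussianReal 0 N)) :=
    isMarkovKernel_noiseKernel (by fun_prop) _
  set k : ℝ := ((V / (V + N) : ℝ≥0) : ℝ) with hk
  have hW : ((V * N / (V + N) : ℝ≥0) : ℝ) = k * N := by
    rw [hk, ← NNReal.coe_mul, div_mul_eq_mul_div]
  rw [← compProd_map_prodMk (κ := Kernel.const ℝ (gaussianReal 0 N)) (g := fun x e => x + e)
    (by fun_prop) (fun x => by rw [noiseKernel_apply (by fun_prop), Kernel.const_apply]),
    Measure.compProd_const, Measure.map_map (by fun_prop) (by fun_prop)]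
  -- The state is recovered as `x = k y + r` with the residual `r = (1 - k) x - k e` independent of
  -- `y`, so both sides are images of the same product law.
  rw [← compProd_map_prodMk (κ := Kernel.const ℝ (gaussianReal ((1 - k) * m) (V * N / (V + N))))
    (g := fun y r => k * y + r) (by fun_prop) (fun y => ?_), Measure.compProd_const,
    ← gaussianReal_prod_map_regression m V N k _ (one_sub_gain_mul V N) hW,
    Measure.map_map (by fun_prop) (by fun_prop)]
  · congr 1
    funext p
    exact Prod.ext rfl (by simp; ring)
  · rw [Kernel.const_apply, gaussianReal_map_const_add, gaussianKernel_apply]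
    congr 1
    ring

/-- The distribution of the conditional mean of `x` given `x + e`. -/
theorem gaussianReal_map_gain (m : ℝ) (V N : ℝ≥0) :
    (gaussianReal m (V + N)).map (fun y => m + ((V / (V + N) : ℝ≥0) : ℝ) * (y - m)) =
      gaussianReal m (V ^ 2 / (V + N)) := by
  set k : ℝ≥0 := V / (V + N) with hk
  have hv : V ^ 2 / (V + N) = k ^ 2 * (V + N) := by
    rcases eq_or_ne (V + N) 0 with h | h
    · simp [h]
    · rw [hk, div_pow, sq (V + N), div_mul_eq_mul_div, mul_div_mul_right _ _ h]
  have h : (fun y => m + (k : ℝ) * (y - m)) = fun y => (1 - k) * m + k * y := by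
    funext y; ring
  rw [h, gaussianReal_map_affine _ _ _ _ (V ^ 2 / (V + N)) (by rw [hv]; push_cast; ring)]
  congr 1
  ring

theorem comp_noiseKernel {S S' : Type*} [MeasurableSpace S] [MeasurableSpace S'] {F : S × ℝ → S'}
    (hF : Measurable F) (μ : Measure S) [SFinite μ] (ν : Measure ℝ) [SFinite ν] :
    noiseKernel F ν ∘ₘ μ = (μ.prod ν).map F := by
  rw [noiseKernel, ← Measure.map_comp _ _ hF, ← Measure.compProd_eq_comp_prod,
    Measure.compProd_const]

theorem gaussianReal_prod_map_add_sub (m₁ m₂ : ℝ) (v₁ v₂ : ℝ≥0) (a : ℝ) :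
    ((gaussianReal m₁ v₁).prod (gaussianReal m₂ v₂)).map (fun p => p.1 + a - p.2) =
      gaussianReal (m₁ + a - m₂) (v₁ + v₂) := by
  have h : (fun p : ℝ × ℝ => p.1 + a - p.2) =
      (fun p => p.1 + p.2) ∘ Prod.map (fun x => x + a) (fun x => -x) := by
    funext p; simp [sub_eq_add_neg]
  rw [h, ← Measure.map_map (by fun_prop) (by fun_prop), ← Measure.map_prod_map _ _ (by fun_prop)
    (by fun_prop), gaussianReal_map_add_const, gaussianReal_map_neg, gaussianReal_prod_map_add,
    sub_eq_add_neg]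

/-- Used to merge the demand `D*_t` with the variable `Z_t` inside `h*_t`. -/
theorem gaussianReal_prod_map_sub_add (m₁ m₂ : ℝ) (v₁ v₂ : ℝ≥0) (b : ℝ) :
    ((gaussianReal m₁ v₁).prod (gaussianReal m₂ v₂)).map (fun p => b - p.1 + p.2) =
      gaussianReal (b - m₁ + m₂) (v₁ + v₂) := by
  have h : (fun p : ℝ × ℝ => b - p.1 + p.2) =
      (fun p => p.1 + p.2) ∘ Prod.map (fun x => b - x) (fun x => x) := by
    funext p; simp
  rw [h, ← Measure.map_map (by fun_prop) (by fun_prop), ← Measure.map_prod_map _ _ (by fun_prop)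
    (by fun_prop), gaussianReal_map_const_sub, Measure.map_id', gaussianReal_prod_map_add]

end Gaussian

/-! ### Conditional distributions of hidden states -/

namespace POMDP

variable {X Y A : Type*} [MeasurableSpace X] [MeasurableSpace Y] [MeasurableSpace A]
variable (M : POMDP X Y A)

/-- The observation depends only on the action and the new state, so averaging over `z` can be done
before observing. This is prediction followed by observation, the form to which the regression
applies. -/
theorem beliefJoint_apply (t : ℕ) (z : ProbabilityMeasure X) (a : A) :
    M.beliefJoint t (z, a) =
      (((M.trans t).comap (fun x => (x, a)) (by fun_prop) ∘ₘ (z : Measure X)) ⊗ₘ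
        (M.obs t).comap (fun x => (a, x)) (by fun_prop)).map Prod.swap := by
  rw [beliefJoint, Kernel.map_apply _ measurable_swap]
  congr 1
  ext s hs
  have hm : Measurable fun x => M.obs t (a, x) (Prod.mk x ⁻¹' s) :=
    Kernel.measurable_kernel_prodMk_left
      (κ := (M.obs t).comap (fun x => (a, x)) (by fun_prop)) hs
  rw [Kernel.comp_apply' _ _ _ hs, Kernel.prod_apply, Kernel.deterministic_apply,
    Measure.prod_dirac, lintegral_map ((M.joint t).measurable_coe hs) (by fun_prop),
    Measure.compProd_apply hs,
    Measure.lintegral_bind (Kernel.aemeasurable _) (by exact hm.aemeasurable)]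
  refine lintegral_congr fun x => ?_
  rw [joint, Kernel.compProd_apply hs]
  rfl

/-- The kernel defined by a measurable function with values in probability measures. -/
def beliefKernel {E : Type*} [MeasurableSpace E] (b : E → ProbabilityMeasure X)
    (hb : Measurable b) : Kernel E X :=
  ⟨fun e => (b e : Measure X), measurable_subtype_coe.comp hb⟩

instance {E : Type*} [MeasurableSpace E] (b : E → ProbabilityMeasure X) (hb : Measurable b) :
    IsMarkovKernel (beliefKernel b hb) :=
  ⟨fun e => inferInstanceAs (IsProbabilityMeasure (b e : Measure X))⟩

theorem measurable_obsTraj : Measurable (obsTraj : (ℕ → (X × Y) × A) → ℕ → Y × A) :=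
  measurable_trajRelabel measurable_observe

variable (π : Policy Y A) {t : ℕ} {b : Hist Y A t → ProbabilityMeasure X} {hb : Measurable b}

/-- The action rule factors through the observed history, so adding the hidden state to the
conditioning changes nothing. -/
theorem hasCondDistrib_action (t : ℕ) :
    HasCondDistrib (fun ω => (ω t).2) (fun ω => (hist t (obsTraj ω), (ω t).1.1))
      ((π.rule t).prodMkRight X) (M.law π) := by
  have h := (M.full.isLaw_law (π.comap observe measurable_observe)).action t
  exact HasCondDistrib.comp_right (κ := (π.rule t).prodMkRight X)
    (f := fun p : Hist (X × Y) A t => (Hist.relabel observe t p, p.2.1))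
    (hf := (Hist.measurable_relabel measurable_observe t).prodMk (by fun_prop)) h

variable {M π} in
/-- The action does not carry information on the hidden state. -/
theorem hasCondDistrib_state
    (h : HasCondDistrib (fun ω => (ω t).1.1) (fun ω => hist t (obsTraj ω)) (beliefKernel b hb)
      (M.law π)) :
    HasCondDistrib (fun ω => (ω t).1.1) (fun ω => (hist t (obsTraj ω), (ω t).2))
      ((beliefKernel b hb).prodMkRight A) (M.law π) :=
  h.swap (M.hasCondDistrib_action π t)

variable {M π} in
-- The belief on `x_t` is unaffected by learning `a_t`. Generating the next pair from `x_t` and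
-- integrating `x_t` out therefore gives the mixture that defines `beliefJoint`.
theorem hasCondDistrib_next
    (h : HasCondDistrib (fun ω => (ω t).1.1) (fun ω => hist t (obsTraj ω)) (beliefKernel b hb)
      (M.law π)) :
    HasCondDistrib (fun ω => ((ω (t + 1)).1.2, (ω (t + 1)).1.1))
      (fun ω => (hist t (obsTraj ω), (ω t).2))
      ((M.beliefJoint t).comap (fun p : Hist Y A t × A => (b p.1, p.2)) (by fun_prop))
      (M.law π) := by
  have h1 := (M.full.isLaw_law (π.comap observe measurable_observe)).trans t
  have h2 : HasCondDistrib (fun ω : ℕ → (X × Y) × A => (ω (t + 1)).1)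
      (fun ω => ((hist t (obsTraj ω), (ω t).2), (ω t).1.1))
      ((M.joint t).comap (fun q : (Hist Y A t × A) × X => (q.2, q.1.2)) (by fun_prop))
      (M.law π) :=
    HasCondDistrib.comp_right (Z := fun ω => (hist t ω, (ω t).2))
      (κ := (M.joint t).comap (fun q : (Hist Y A t × A) × X => (q.2, q.1.2)) (by fun_prop))
      (f := fun p : Hist (X × Y) A t × A => ((Hist.relabel observe t p.1, p.2), p.1.2.1))
      (hf := (((Hist.measurable_relabel measurable_observe t).comp measurable_fst).prodMk
        measurable_snd).prodMk (by fun_prop)) h1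
  have h3 := ((hasCondDistrib_state h).prodMk h2).snd.comp_left measurable_swap
  refine Eq.subst (motive := fun κ => HasCondDistrib
    (fun ω => ((ω (t + 1)).1.2, (ω (t + 1)).1.1)) (fun ω => (hist t (obsTraj ω), (ω t).2)) κ
    (M.law π)) ?_ h3
  ext1 p
  symm
  rw [Kernel.comap_apply, beliefJoint, Kernel.map_apply _ measurable_swap,
    Kernel.map_apply _ measurable_swap]
  congr 1
  ext s hs
  rw [Kernel.comp_apply' _ _ _ hs, Kernel.prod_apply, Kernel.deterministic_apply,
    Measure.prod_dirac, lintegral_map ((M.joint t).measurable_coe hs) (by fun_prop),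
    Kernel.snd_apply' _ _ hs, Kernel.compProd_apply (measurable_snd hs)]
  rfl

end POMDP

/-! ### Normal beliefs -/

namespace GaussianInventory

variable (G : GaussianInventory)

@[fun_prop]
theorem measurable_normalBelief (t : ℕ) : Measurable (G.normalBelief t) :=
  Measurable.subtype_mk (measurable_gaussianReal.comp (measurable_id.prodMk measurable_const))

theorem measurable_nextMean (t : ℕ) : Measurable fun p : (ℝ × ℝ≥0) × ℝ =>
    G.nextMean t p.1.1 p.1.2 p.2 := by
  unfold nextMean; fun_prop

theorem measurable_nextMean_apply (t : ℕ) (x : ℝ) (a : ℝ≥0) : Measurable (G.nextMean t x a) :=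
  (G.measurable_nextMean t).comp (measurable_prodMk_left (x := (x, a)))

theorem beliefJointInit_eq : G.pomdp.beliefJointInit =
    gaussianReal G.xMean (G.xVar + G.nVar 0) ⊗ₘ gaussianKernel
      (fun y => G.xMean + ((G.xVar / (G.xVar + G.nVar 0) : ℝ≥0) : ℝ) * (y - G.xMean))
      (by fun_prop) (G.postVar 0) :=
  map_swap_compProd_noiseKernel G.xMean G.xVar (G.nVar 0)

/-- Prediction adds the demand variance; the observation is then a regression with `V = postVar t +
dVar t` and `N = nVar (t + 1)`. -/
theorem beliefJoint_normalBelief (t : ℕ) (x : ℝ) (a : ℝ≥0) :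
    G.pomdp.beliefJoint t (G.normalBelief t x, a) =
      gaussianReal (x + a - G.dMean t) (G.postVar t + G.dVar t + G.nVar (t + 1)) ⊗ₘ
        gaussianKernel (G.nextMean t x a) (G.measurable_nextMean_apply t x a)
          (G.postVar (t + 1)) := by
  have h1 : (G.pomdp.trans t).comap (fun x => (x, a)) (by fun_prop) =
      noiseKernel (fun p : ℝ × ℝ => p.1 + a - p.2) (gaussianReal (G.dMean t) (G.dVar t)) := by
    ext1 x
    rw [Kernel.comap_apply, noiseKernel_apply (by fun_prop)]
    exact noiseKernel_apply (by fun_prop) _ _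
  have h2 : (G.pomdp.obs t).comap (fun x => (a, x)) (by fun_prop) =
      noiseKernel (fun p : ℝ × ℝ => p.1 + p.2) (gaussianReal 0 (G.nVar (t + 1))) := by
    ext1 x
    rw [Kernel.comap_apply, noiseKernel_apply (by fun_prop)]
    exact noiseKernel_apply (by fun_prop) _ _
  have h3 : ((G.normalBelief t x : ProbabilityMeasure ℝ) : Measure ℝ) =
    gaussianReal x (G.postVar t) := rfl
  rw [POMDP.beliefJoint_apply, h1, h2, h3, comp_noiseKernel (by fun_prop),
    gaussianReal_prod_map_add_sub]
  exact map_swap_compProd_noiseKernel _ _ _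

theorem fst_beliefJoint_normalBelief (t : ℕ) (x : ℝ) (a : ℝ≥0) :
    (G.pomdp.beliefJoint t).fst (G.normalBelief t x, a) =
      gaussianReal (x + a - G.dMean t) (G.postVar t + G.dVar t + G.nVar (t + 1)) := by
  rw [Kernel.fst_apply, beliefJoint_normalBelief]
  exact Measure.fst_compProd _ _

/-- The law of total variance: the predicted variance is that of the next mean plus the remaining
posterior variance. -/
theorem starVar_add_postVar (t : ℕ) :
    G.starVar t + G.postVar (t + 1) = G.postVar t + G.dVar t := by
  rw [starVar, postVar]
  generalize G.postVar t + G.dVar t = V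
  rcases eq_or_ne (V + G.nVar (t + 1)) 0 with h | h
  · simp [(add_eq_zero.1 h).1]
  · rw [← add_div, sq, ← mul_add, mul_div_assoc, div_self h, mul_one]

/-- The distribution of the next mean belief. -/
theorem map_nextMean (t : ℕ) (x : ℝ) (a : ℝ≥0) :
    (gaussianReal (x + a - G.dMean t) (G.postVar t + G.dVar t + G.nVar (t + 1))).map
        (G.nextMean t x a) =
      gaussianReal (x + a - G.dMean t) (G.starVar t) :=
  gaussianReal_map_gain _ _ _

theorem meanMDP_trans_apply (t : ℕ) (x : ℝ) (a : ℝ≥0) :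
    G.meanMDP.trans t (x, a) = gaussianReal (x + a - G.dMean t) (G.starVar t) := by
  refine (noiseKernel_apply (by fun_prop) _ _).trans ?_
  exact gaussianReal_map_const_sub (μ := G.dMean t) (v := G.starVar t) (x + a)

/-! ### One-step costs: measurability, and agreement of the models -/

theorem continuous_h : Continuous G.h := by
  rw [← continuousOn_univ]
  exact G.h_convex.continuousOn isOpen_univ

@[fun_prop]
theorem measurable_ofReal_h : Measurable fun x => ENNReal.ofReal (G.h x) :=
  G.continuous_h.measurable.ennreal_ofReal

theorem pomdp_cost_eq (t : ℕ) (x : ℝ) (a : ℝ≥0) : G.pomdp.cost t x a = orderCost G.K G.c a +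
    ∫⁻ d, ENNReal.ofReal (G.h (x + a - d)) ∂gaussianReal (G.dMean t) (G.dVar t) := rfl

theorem meanMDP_cost_eq (t : ℕ) (x : ℝ) (a : ℝ≥0) : G.meanMDP.cost t x a = orderCost G.K G.c a +
    ∫⁻ d, G.starHold t (x + a - d) ∂gaussianReal (G.dMean t) (G.starVar t) := rfl

@[fun_prop]
theorem measurable_orderCost (K c : ℝ≥0) : Measurable (orderCost K c) := by
  unfold orderCost
  refine Measurable.add (Measurable.ite (measurableSet_lt measurable_const measurable_id)
    measurable_const measurable_const) ?_
  fun_prop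

@[fun_prop]
theorem measurable_starHold (t : ℕ) : Measurable (G.starHold t) := by
  refine Measurable.lintegral_prod_right'
    (f := fun p : ℝ × ℝ => ENNReal.ofReal (G.h (p.1 + p.2))) ?_
  exact G.measurable_ofReal_h.comp (by fun_prop)

theorem measurable_pomdp_cost (t : ℕ) : Measurable (Function.uncurry (G.pomdp.cost t)) := by
  refine ((measurable_orderCost _ _).comp measurable_snd).add ?_
  refine Measurable.lintegral_prod_right'
    (f := fun p : (ℝ × ℝ≥0) × ℝ => ENNReal.ofReal (G.h (p.1.1 + p.1.2 - p.2))) ?_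
  exact G.measurable_ofReal_h.comp (by fun_prop)

theorem measurable_meanMDP_cost (t : ℕ) : Measurable (Function.uncurry (G.meanMDP.cost t)) := by
  refine ((measurable_orderCost _ _).comp measurable_snd).add ?_
  refine Measurable.lintegral_prod_right'
    (f := fun p : (ℝ × ℝ≥0) × ℝ => G.starHold t (p.1.1 + p.1.2 - p.2)) ?_
  exact (G.measurable_starHold t).comp (by fun_prop)

theorem measurable_beliefMDP_cost (t : ℕ) :
    Measurable (Function.uncurry (G.pomdp.beliefMDP.cost t)) := by
  have h : Measurable (Function.uncurry fun (p : ProbabilityMeasure ℝ × ℝ≥0) (x : ℝ) =>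
      G.pomdp.cost t x p.2) :=
    (G.measurable_pomdp_cost t).comp (by fun_prop : Measurable
      fun q : (ProbabilityMeasure ℝ × ℝ≥0) × ℝ => (q.2, q.1.2))
  exact h.lintegral_kernel_prod_right (κ := POMDP.currentState ℝ ℝ≥0)

/-- By Tonelli both holding costs are integrals of `h` against the normal law of the predicted
level: once as belief minus `D_t`, once as mean minus `D*_t` plus `Z_t`. -/
theorem lintegral_pomdp_cost (t : ℕ) (x : ℝ) (a : ℝ≥0) :
    ∫⁻ u, G.pomdp.cost t u a ∂gaussianReal x (G.postVar t) = G.meanMDP.cost t x a := by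
  have hh := G.measurable_ofReal_h
  have h1 : ∫⁻ u, ∫⁻ d, ENNReal.ofReal (G.h (u + a - d)) ∂gaussianReal (G.dMean t) (G.dVar t)
      ∂gaussianReal x (G.postVar t) =
      ∫⁻ y, ENNReal.ofReal (G.h y) ∂gaussianReal (x + a - G.dMean t)
        (G.postVar t + G.dVar t) := by
    rw [← gaussianReal_prod_map_add_sub, lintegral_map hh (by fun_prop), lintegral_prod]
    exact (hh.comp (by fun_prop : Measurable fun p : ℝ × ℝ => p.1 + a - p.2)).aemeasurable
  have h2 : ∫⁻ d, G.starHold t (x + a - d) ∂gaussianReal (G.dMean t) (G.starVar t) =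
      ∫⁻ y, ENNReal.ofReal (G.h y) ∂gaussianReal (x + a - G.dMean t)
        (G.postVar t + G.dVar t) := by
    rw [← G.starVar_add_postVar t, ← add_zero (x + a - G.dMean t),
      ← gaussianReal_prod_map_sub_add, lintegral_map hh (by fun_prop), lintegral_prod]
    · rfl
    · exact (hh.comp (by fun_prop : Measurable fun p : ℝ × ℝ => x + a - p.1 + p.2)).aemeasurable
  rw [meanMDP_cost_eq, h2, ← h1]
  simp only [pomdp_cost_eq]
  rw [lintegral_add_left measurable_const, lintegral_const, measure_univ, mul_one]

/-! ### The belief MDP on normal beliefs -/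

theorem beliefMDP_cost_normalBelief (t : ℕ) (x : ℝ) (a : ℝ≥0) :
    G.pomdp.beliefMDP.cost t (G.normalBelief t x) a = G.meanMDP.cost t x a :=
  G.lintegral_pomdp_cost t x a

theorem filterInit_ae_eq : ∀ᵐ y ∂gaussianReal G.xMean (G.xVar + G.nVar 0),
    G.pomdp.filterInit y = G.normalBelief 0
      (G.xMean + ((G.xVar / (G.xVar + G.nVar 0) : ℝ≥0) : ℝ) * (y - G.xMean)) := by
  have h : G.pomdp.beliefJointInit.fst = gaussianReal G.xMean (G.xVar + G.nVar 0) := by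
    rw [beliefJointInit_eq, Measure.fst_compProd]
  have h2 := eq_condKernel_of_measure_eq_compProd _
    (h.symm ▸ G.beliefJointInit_eq :
      G.pomdp.beliefJointInit = G.pomdp.beliefJointInit.fst ⊗ₘ _)
  rw [h] at h2
  filter_upwards [h2] with y hy
  exact Subtype.ext hy.symm

theorem beliefMDP_init : G.pomdp.beliefMDP.init = G.meanMDP.init.map (G.normalBelief 0) := by
  have h : G.pomdp.beliefJointInit.fst = gaussianReal G.xMean (G.xVar + G.nVar 0) := by
    rw [beliefJointInit_eq, Measure.fst_compProd]
  change G.pomdp.beliefJointInit.fst.map G.pomdp.filterInit =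
    (gaussianReal G.xMean (G.xVar ^ 2 / (G.xVar + G.nVar 0))).map (G.normalBelief 0)
  rw [h, Measure.map_congr G.filterInit_ae_eq, ← gaussianReal_map_gain,
    Measure.map_map (by fun_prop) (by fun_prop)]
  rfl

theorem filter_ae_eq (t : ℕ) (x : ℝ) (a : ℝ≥0) :
    ∀ᵐ y ∂(G.pomdp.beliefJoint t).fst (G.normalBelief t x, a),
      G.pomdp.filter t ((G.normalBelief t x, a), y) =
        G.normalBelief (t + 1) (G.nextMean t x a y) := by
  -- The filter is a disintegration of a whole kernel. At a fixed belief and action it agrees almost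
  -- everywhere with the disintegration of one measure, which is almost everywhere unique.
  have h1 := Kernel.condKernel_apply_eq_condKernel (G.pomdp.beliefJoint t) (G.normalBelief t x, a)
  have h := G.beliefJoint_normalBelief t x a
  rw [← G.fst_beliefJoint_normalBelief t x a, Kernel.fst_apply] at h
  have h2 := eq_condKernel_of_measure_eq_compProd _ h
  rw [Measure.fst, ← Kernel.fst_apply] at h2
  filter_upwards [h1, h2] with y hy1 hy2
  exact Subtype.ext (hy1.trans hy2.symm)

theorem beliefMDP_trans_normalBelief (t : ℕ) (x : ℝ) (a : ℝ≥0) :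
    G.pomdp.beliefMDP.trans t (G.normalBelief t x, a) =
      (G.meanMDP.trans t (x, a)).map (G.normalBelief (t + 1)) := by
  have h : G.pomdp.beliefMDP.trans t (G.normalBelief t x, a) =
      ((G.pomdp.beliefJoint t).fst (G.normalBelief t x, a)).map
        fun y => G.pomdp.filter t ((G.normalBelief t x, a), y) := by
    change (Kernel.id ×ₖ (G.pomdp.beliefJoint t).fst).map (G.pomdp.filter t) _ = _
    rw [Kernel.map_apply _ (G.pomdp.measurable_filter t), Kernel.prod_apply, Kernel.id_apply,
      Measure.dirac_prod, Measure.map_map (G.pomdp.measurable_filter t) (by fun_prop)]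
    rfl
  rw [h, Measure.map_congr (G.filter_ae_eq t x a), meanMDP_trans_apply,
    fst_beliefJoint_normalBelief, ← G.map_nextMean, Measure.map_map (by fun_prop)]
  · rfl
  · exact G.measurable_nextMean_apply t x a

end GaussianInventory

theorem Hist.upTo_snoc {S A : Type*} {t : ℕ} (p : (Hist S A t × A) × S) :
    (Hist.snoc p).upTo (Fin.last t) = p.1.1 := by
  refine Prod.ext (funext fun j => ?_) ?_
  · exact Fin.snoc_castSucc (α := fun _ => S × A) _ _ j
  · exact congrArg Prod.fst (Fin.snoc_last (α := fun _ => S × A) _ _)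

namespace GaussianInventory

variable (G : GaussianInventory)

/-! ### Mean beliefs along trajectories of the partially observable problem -/

theorem meanBelief_snoc (t : ℕ) (p : (Hist ℝ ℝ≥0 t × ℝ≥0) × ℝ) :
    G.meanBelief (t + 1) (Hist.snoc p) = G.nextMean t (G.meanBelief t p.1.1) p.1.2 p.2 := by
  have h : ((Hist.snoc p).1 (Fin.last t)).2 = p.1.2 :=
    congrArg Prod.snd (Fin.snoc_last (α := fun _ => ℝ × ℝ≥0) _ _)
  rw [meanBelief, Hist.upTo_snoc, h]
  rfl

/-- The posterior distribution of the inventory level as a function of the observed history. -/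
def posterior (t : ℕ) (h : Hist ℝ ℝ≥0 t) : ProbabilityMeasure ℝ :=
  G.normalBelief t (G.meanBelief t h)

theorem measurable_posterior (t : ℕ) : Measurable (G.posterior t) :=
  (G.measurable_normalBelief t).comp (G.measurable_meanBelief t)

theorem measurable_predMean (t : ℕ) :
    Measurable fun p : Hist ℝ ℝ≥0 t × ℝ≥0 => G.meanBelief t p.1 + p.2 - G.dMean t := by
  have := G.measurable_meanBelief t
  fun_prop

theorem measurable_nextMean_meanBelief (t : ℕ) :
    Measurable fun q : (Hist ℝ ℝ≥0 t × ℝ≥0) × ℝ =>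
      G.nextMean t (G.meanBelief t q.1.1) q.1.2 q.2 := by
  have := G.measurable_meanBelief t
  unfold nextMean
  fun_prop

/-- In this factorization the first kernel is the predictive law of the observation and the second
is the updated posterior. -/
theorem beliefJoint_comap_posterior (t : ℕ) :
    (G.pomdp.beliefJoint t).comap (fun p : Hist ℝ ℝ≥0 t × ℝ≥0 => (G.posterior t p.1, p.2))
        (by have := G.measurable_posterior t; fun_prop) =
      gaussianKernel _ (G.measurable_predMean t)
          (G.postVar t + G.dVar t + G.nVar (t + 1)) ⊗ₖ
        gaussianKernel _ (G.measurable_nextMean_meanBelief t) (G.postVar (t + 1)) := by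
  ext1 p
  rw [Kernel.comap_apply, Kernel.compProd_apply_eq_compProd_sectR]
  exact G.beliefJoint_normalBelief t _ _

variable (π : Policy ℝ ℝ≥0)

theorem map_init_law : (G.pomdp.law π).map (fun ω => ((ω 0).1.2, (ω 0).1.1)) =
    G.pomdp.beliefJointInit := by
  have h := (G.pomdp.full.isLaw_law (π.comap POMDP.observe POMDP.measurable_observe)).init
  have h2 := congrArg (Measure.map Prod.swap) h
  rw [Measure.map_map measurable_swap (by fun_prop)] at h2
  exact h2

theorem map_observation_zero : (G.pomdp.law π).map (fun ω => (ω 0).1.2) =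
    gaussianReal G.xMean (G.xVar + G.nVar 0) := by
  have h := congrArg Measure.fst (G.map_init_law π)
  rw [beliefJointInit_eq, Measure.fst_compProd, Measure.fst,
    Measure.map_map (by fun_prop) (by fun_prop)] at h
  exact h

/-- Induction by Bayes' rule: the second factor of the joint law of the next observation and state
is the law of `x_{t+1}` given `(h_t, a_t, y_{t+1})`, and these data form `h_{t+1}`. -/
theorem hasCondDistrib_posterior (t : ℕ) :
    HasCondDistrib (fun ω => (ω t).1.1) (fun ω => hist t (POMDP.obsTraj ω))
      (POMDP.beliefKernel (G.posterior t) (G.measurable_posterior t)) (G.pomdp.law π) := by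
  induction t with
  | zero =>
    have h : HasCondDistrib (fun ω : ℕ → (ℝ × ℝ) × ℝ≥0 => (ω 0).1.1) (fun ω => (ω 0).1.2)
        ((POMDP.beliefKernel (G.posterior 0) (G.measurable_posterior 0)).comap
          (fun y => ((Fin.elim0, y) : Hist ℝ ℝ≥0 0)) (by fun_prop)) (G.pomdp.law π) := by
      refine ⟨by fun_prop, ?_⟩
      rw [map_init_law, map_observation_zero, beliefJointInit_eq]
      rfl
    have h2 := h.comp_right
    convert h2 using 1
    funext ω
    exact Prod.ext (Subsingleton.elim _ _) rfl
  | succ t ih =>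
    have h := POMDP.hasCondDistrib_next ih
    rw [beliefJoint_comap_posterior] at h
    have h2 := h.of_compProd
    have h3 : gaussianKernel _ (G.measurable_nextMean_meanBelief t) (G.postVar (t + 1)) =
        (POMDP.beliefKernel (G.posterior (t + 1)) (G.measurable_posterior (t + 1))).comap Hist.snoc
          Hist.measurable_snoc := by
      ext1 p
      change gaussianReal _ _ = gaussianReal _ _
      rw [meanBelief_snoc]
    rw [h3] at h2
    have h4 := h2.comp_right
    convert h4 using 1
    funext ω
    exact hist_succ t (POMDP.obsTraj ω)

theorem hasCondDistrib_observation (t : ℕ) :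
    HasCondDistrib (fun ω => (ω (t + 1)).1.2) (fun ω => (hist t (POMDP.obsTraj ω), (ω t).2))
      (gaussianKernel _ (G.measurable_predMean t) (G.postVar t + G.dVar t + G.nVar (t + 1)))
      (G.pomdp.law π) := by
  have h := (POMDP.hasCondDistrib_next (G.hasCondDistrib_posterior π t)).fst
  rwa [beliefJoint_comap_posterior, Kernel.fst_compProd] at h

theorem hasCondDistrib_meanBelief (t : ℕ) :
    HasCondDistrib (fun ω => (G.beliefTraj ω (t + 1)).1)
      (fun ω => (hist t (POMDP.obsTraj ω), (ω t).2))
      (gaussianKernel _ (G.measurable_predMean t) (G.starVar t)) (G.pomdp.law π) :=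
  (G.hasCondDistrib_observation π t).comp_prod
    (g := fun p y => G.nextMean t (G.meanBelief t p.1) p.2 y)
    (G.measurable_nextMean_meanBelief t) fun _ => G.map_nextMean t _ _

/-- Subtracting the next mean from `x̄_t + a_t` cancels the dependence on the past. A constant
kernel encodes both the law of `D*_t` and its independence of `(h_t, a_t)`. -/
theorem hasCondDistrib_starDemand (t : ℕ) :
    HasCondDistrib (G.starDemand t) (fun ω => (hist t (POMDP.obsTraj ω), (ω t).2))
      (Kernel.const _ (gaussianReal (G.dMean t) (G.starVar t))) (G.pomdp.law π) := by
  have hm := G.measurable_meanBelief t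
  refine (G.hasCondDistrib_meanBelief π t).comp_prod
    (g := fun p x => G.meanBelief t p.1 + p.2 - x) (by fun_prop) fun p => ?_
  rw [gaussianKernel_apply, gaussianReal_map_const_sub, Kernel.const_apply]
  congr 1
  ring

theorem measurable_beliefTraj : Measurable G.beliefTraj :=
  (measurable_trajRelabel G.measurable_meanBelief).comp POMDP.measurable_obsTraj

theorem map_beliefTraj_zero : (G.pomdp.law π).map (fun ω => (G.beliefTraj ω 0).1) =
    gaussianReal G.xMean (G.xVar ^ 2 / (G.xVar + G.nVar 0)) := by
  rw [← gaussianReal_map_gain, ← G.map_observation_zero π,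
    Measure.map_map (by fun_prop) (by fun_prop)]
  rfl

theorem iIndepFun_starDemand : iIndepFun G.starDemand (G.pomdp.law π) := by
  refine iIndepFun_of_indepFun_past (U := fun t ω => (hist t (POMDP.obsTraj ω), (ω t).2))
    (fun s t hst => ?_) fun t => (G.hasCondDistrib_starDemand π t).indepFun
  have h1 {r : ℕ} (i : Fin r) :
      Measurable fun p : Hist ℝ ℝ≥0 r × ℝ≥0 => G.meanBelief i (p.1.upTo i) :=
    ((G.measurable_meanBelief i).comp (Hist.measurable_upTo i)).comp measurable_fst
  -- `D*_s` needs the means at `s` and `s + 1`. If `s + 1 = t`, the latter comes from the full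
  -- history, which `upTo` does not produce.
  rcases (Nat.succ_le_of_lt hst).eq_or_lt with rfl | h
  · refine ⟨fun p => G.meanBelief s (p.1.upTo (Fin.last s)) + (p.1.1 (Fin.last s)).2 -
      G.meanBelief (s + 1) p.1, ?_, fun ω => rfl⟩
    exact ((h1 (Fin.last s)).add (by fun_prop)).sub
      ((G.measurable_meanBelief (s + 1)).comp measurable_fst)
  · refine ⟨fun p => G.meanBelief s (p.1.upTo ⟨s, hst⟩) + (p.1.1 ⟨s, hst⟩).2 -
      G.meanBelief (s + 1) (p.1.upTo ⟨s + 1, h⟩), ?_, fun ω => rfl⟩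
    exact ((h1 ⟨s, hst⟩).add (by fun_prop)).sub (h1 ⟨s + 1, h⟩)

/-! ### Transfer of policies and values to the mean MDP -/

theorem map_beliefTraj_eq {π ψ : Policy ℝ ℝ≥0}
    (h : ∀ t, HasCondDistrib (fun ω => (ω t).2) (fun ω => hist t (G.beliefTraj ω)) (ψ.rule t)
      (G.pomdp.law π)) : (G.pomdp.law π).map G.beliefTraj = G.meanMDP.law ψ := by
  refine MDP.map_eq_law G.measurable_beliefTraj (G.map_beliefTraj_zero π) h fun t => ?_
  -- Given the observed past, the next mean depends only on the current mean and action, so the same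
  -- kernel serves for the coarser past of mean beliefs.
  refine HasCondDistrib.comp_right (Z := fun ω => (hist t (POMDP.obsTraj ω), (ω t).2))
    (f := fun p : Hist ℝ ℝ≥0 t × ℝ≥0 => (Hist.relabel G.meanBelief t p.1, p.2))
    (hf := ((Hist.measurable_relabel G.measurable_meanBelief t).comp measurable_fst).prodMk
      measurable_snd) ?_
  convert G.hasCondDistrib_meanBelief π t using 1
  ext1 p
  exact G.meanMDP_trans_apply t _ _

/-- Conditioning each cost on `(h_t, a_t)` averages it over the normal posterior, which gives the
mean MDP cost. -/
theorem pomdp_value_eq {π ψ : Policy ℝ ℝ≥0}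
    (h : (G.pomdp.law π).map G.beliefTraj = G.meanMDP.law ψ) (α : ℝ≥0) (T : ℕ∞) :
    G.pomdp.value π α T = G.meanMDP.value ψ α T := by
  have hc (t : ℕ) : Measurable fun p : (ℝ × ℝ) × ℝ≥0 => G.pomdp.cost t p.1.1 p.2 :=
    (G.measurable_pomdp_cost t).comp (by fun_prop : Measurable
      fun p : (ℝ × ℝ) × ℝ≥0 => (p.1.1, p.2))
  rw [POMDP.value, MDP.value_eq_tsum (fun t => hc t),
    MDP.value_eq_tsum (fun t => G.measurable_meanMDP_cost t)]
  refine tsum_congr fun t => ?_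
  have hcost : Measurable (Function.uncurry fun (p : Hist ℝ ℝ≥0 t × ℝ≥0) (x : ℝ) =>
      G.pomdp.cost t x p.2) :=
    (G.measurable_pomdp_cost t).comp (by fun_prop : Measurable
      fun p : (Hist ℝ ℝ≥0 t × ℝ≥0) × ℝ => (p.2, p.1.2))
  have h1 := (POMDP.hasCondDistrib_state (G.hasCondDistrib_posterior π t)).lintegral hcost
  have h2 : ∫⁻ ω, G.meanMDP.cost t (ω t).1 (ω t).2 ∂G.meanMDP.law ψ =
      ∫⁻ ω, G.meanMDP.cost t (G.beliefTraj ω t).1 (G.beliefTraj ω t).2 ∂G.pomdp.law π := by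
    rw [← h]
    exact lintegral_map ((G.measurable_meanMDP_cost t).comp (measurable_pi_apply t))
      G.measurable_beliefTraj
  have h3 : ∫⁻ ω, G.pomdp.full.cost t (ω t).1 (ω t).2
      ∂G.pomdp.full.law (π.comap POMDP.observe POMDP.measurable_observe) =
      ∫⁻ ω, G.meanMDP.cost t (ω t).1 (ω t).2 ∂G.meanMDP.law ψ := by
    rw [h2]
    refine h1.trans (lintegral_congr fun ω => ?_)
    exact G.lintegral_pomdp_cost t _ _
  rw [h3]

/-- The policy `ψ` is the conditional law of `a_t` given past mean beliefs and actions. It is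
randomized in general, since it averages out whatever else `π` uses. -/
theorem exists_policy_map_beliefTraj : ∃ ψ : Policy ℝ ℝ≥0,
    (G.pomdp.law π).map G.beliefTraj = G.meanMDP.law ψ := by
  have hT := G.measurable_beliefTraj
  refine ⟨⟨fun t => condDistrib (fun ω => (ω t).2) (fun ω => hist t (G.beliefTraj ω))
    (G.pomdp.law π), fun t => inferInstance⟩, G.map_beliefTraj_eq fun t => ⟨?_, ?_⟩⟩
  · fun_prop
  · exact (compProd_map_condDistrib (Measurable.aemeasurable (by fun_prop))).symm

theorem map_beliefTraj_comap (ψ : Policy ℝ ℝ≥0) :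
    (G.pomdp.law (ψ.comap G.meanBelief G.measurable_meanBelief)).map G.beliefTraj =
      G.meanMDP.law ψ := by
  refine G.map_beliefTraj_eq fun t => ?_
  have h := G.pomdp.hasCondDistrib_action (ψ.comap G.meanBelief G.measurable_meanBelief) t
  exact HasCondDistrib.comp_right (κ := ψ.rule t)
    (f := fun p : Hist ℝ ℝ≥0 t × ℝ => Hist.relabel G.meanBelief t p.1)
    (hf := (Hist.measurable_relabel G.measurable_meanBelief t).comp measurable_fst) h

/-! ### Equivalence of the belief MDP and the mean MDP -/

/-- The image of the mean process has the initial law, actions and transitions of the belief MDP. It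
visits only normal beliefs, so the filter at other beliefs plays no role. -/
theorem beliefMDP_law_eq (β : Policy (ProbabilityMeasure ℝ) ℝ≥0) :
    G.pomdp.beliefMDP.law β =
      (G.meanMDP.law (β.comap G.toBelief G.measurable_toBelief)).map (trajRelabel G.toBelief) := by
  have hl := G.meanMDP.isLaw_law (β.comap G.toBelief G.measurable_toBelief)
  refine (MDP.map_eq_law (measurable_trajRelabel G.measurable_toBelief) ?_ (fun t => ?_)
    fun t => ?_).symm
  · rw [beliefMDP_init, ← hl.init, Measure.map_map (by fun_prop) (by fun_prop)]
    rfl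
  · have h : HasCondDistrib (fun ω : ℕ → ℝ × ℝ≥0 => (ω t).2) (hist t) ((β.rule t).comap
        (Hist.relabel G.toBelief t) (Hist.measurable_relabel G.measurable_toBelief t))
        (G.meanMDP.law (β.comap G.toBelief G.measurable_toBelief)) := hl.action t
    exact h.comp_right
  · refine HasCondDistrib.comp_right (Z := fun ω => (hist t ω, (ω t).2))
      (f := fun p : Hist ℝ ℝ≥0 t × ℝ≥0 => (Hist.relabel G.toBelief t p.1, p.2))
      (hf := ((Hist.measurable_relabel G.measurable_toBelief t).comp measurable_fst).prodMk
        measurable_snd) ?_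
    exact (hl.trans t).comp_prod (g := fun _ x => G.normalBelief (t + 1) x)
      ((G.measurable_normalBelief (t + 1)).comp measurable_snd)
      fun _ => (G.beliefMDP_trans_normalBelief t _ _).symm

theorem beliefMDP_value_eq (β : Policy (ProbabilityMeasure ℝ) ℝ≥0) (α : ℝ≥0) (T : ℕ∞) :
    G.pomdp.beliefMDP.value β α T =
      G.meanMDP.value (β.comap G.toBelief G.measurable_toBelief) α T := by
  rw [MDP.value_eq_tsum G.measurable_beliefMDP_cost, MDP.value_eq_tsum G.measurable_meanMDP_cost]
  refine tsum_congr fun t => ?_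
  rw [beliefMDP_law_eq, lintegral_map _ (measurable_trajRelabel G.measurable_toBelief)]
  · simp only [← beliefMDP_cost_normalBelief]
    rfl
  · exact (G.measurable_beliefMDP_cost t).comp (measurable_pi_apply t)

theorem relabel_toMean_toBelief (t : ℕ) (h : Hist ℝ ℝ≥0 t) :
    Hist.relabel toMean t (Hist.relabel G.toBelief t h) = h := by
  refine Prod.ext (funext fun i => Prod.ext ?_ rfl) ?_ <;> exact integral_id_gaussianReal

/-- Since `N(x, σ_t²)` has mean `x`, a policy survives the passage to beliefs and back. Claims for
policies `ψ` thus follow from those for policies `β`. -/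
theorem comap_toMean_comap_toBelief (ψ : Policy ℝ ℝ≥0) :
    (ψ.comap toMean measurable_toMean).comap G.toBelief G.measurable_toBelief = ψ := by
  cases ψ with
  | mk rule markov =>
    simp only [Policy.comap, Policy.mk.injEq]
    funext t
    ext1 h
    exact congrArg (rule t) (G.relabel_toMean_toBelief t h)

end GaussianInventory

/-! ### Holding costs -/

/-- Jensen's inequality for a normal distribution and a convex function with values in
`[0, ∞]`. -/
theorem ConvexOn.le_lintegral_gaussianReal {H : ℝ → ℝ≥0∞} (hH : ConvexOn ℝ≥0 Set.univ H)
    (hm : Measurable H) (v : ℝ≥0) (x : ℝ) : H x ≤ ∫⁻ z, H (x + z) ∂gaussianReal 0 v := by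
  -- By symmetry `x + z` can be paired with `x - z`, so midpoint convexity suffices and no
  -- integrability is needed.
  have hneg : ∫⁻ z, H (x + z) ∂gaussianReal 0 v = ∫⁻ z, H (x + -z) ∂gaussianReal 0 v := by
    have h : gaussianReal 0 v = (gaussianReal 0 v).map fun z => -z := by
      rw [gaussianReal_map_neg, neg_zero]
    conv_lhs => rw [h]
    exact lintegral_map (hm.comp (by fun_prop)) (by fun_prop)
  have hmid (z : ℝ) :
      H x ≤ ((2⁻¹ : ℝ≥0) : ℝ≥0∞) * H (x + z) + ((2⁻¹ : ℝ≥0) : ℝ≥0∞) * H (x + -z) := by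
    have h := hH.2 (Set.mem_univ (x + z)) (Set.mem_univ (x + -z)) (zero_le : 0 ≤ (2⁻¹ : ℝ≥0))
      (zero_le : 0 ≤ (2⁻¹ : ℝ≥0)) (by rw [← two_mul]; exact mul_inv_cancel₀ two_ne_zero)
    have hx : (2⁻¹ : ℝ≥0) • (x + z) + (2⁻¹ : ℝ≥0) • (x + -z) = x := by
      simp only [NNReal.smul_def, NNReal.coe_inv, NNReal.coe_ofNat, smul_eq_mul]
      ring
    rwa [hx] at h
  calc H x = ∫⁻ _, H x ∂gaussianReal 0 v := by simp
    _ ≤ ∫⁻ z, ((2⁻¹ : ℝ≥0) : ℝ≥0∞) * H (x + z) + ((2⁻¹ : ℝ≥0) : ℝ≥0∞) * H (x + -z)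
        ∂gaussianReal 0 v := lintegral_mono hmid
    _ = ∫⁻ z, H (x + z) ∂gaussianReal 0 v := by
      have h1 : Measurable fun z => H (x + z) := hm.comp (by fun_prop)
      have h2 : Measurable fun z => H (x + -z) := hm.comp (by fun_prop)
      rw [lintegral_add_left (h1.const_mul _), lintegral_const_mul _ h1, lintegral_const_mul _ h2,
        ← hneg, ← add_mul, ← ENNReal.coe_add, ← two_mul, mul_inv_cancel₀ two_ne_zero,
        ENNReal.coe_one, one_mul]

namespace GaussianInventory

variable (G : GaussianInventory)

theorem convexOn_ofReal_h : ConvexOn ℝ≥0 Set.univ fun x => ENNReal.ofReal (G.h x) := by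
  refine ⟨convex_univ, fun x _ y _ a b _ _ hab => ?_⟩
  have h := G.h_convex.2 (Set.mem_univ x) (Set.mem_univ y) a.2 b.2
    (congrArg NNReal.toReal hab)
  refine (ENNReal.ofReal_le_ofReal h).trans_eq ?_
  have hx := G.h_nonneg x
  have hy := G.h_nonneg y
  simp only [ENNReal.smul_def, smul_eq_mul]
  rw [ENNReal.ofReal_add (mul_nonneg a.2 hx) (mul_nonneg b.2 hy), ENNReal.ofReal_mul a.2,
    ENNReal.ofReal_mul b.2]
  simp

theorem convexOn_starHold (t : ℕ) : ConvexOn ℝ≥0 Set.univ (G.starHold t) := by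
  refine ⟨convex_univ, fun x _ y _ a b ha hb hab => ?_⟩
  have hm (x : ℝ) : Measurable fun z => ENNReal.ofReal (G.h (x + z)) :=
    G.measurable_ofReal_h.comp (by fun_prop)
  simp only [starHold, ENNReal.smul_def, smul_eq_mul]
  rw [← lintegral_const_mul _ (hm x), ← lintegral_const_mul _ (hm y),
    ← lintegral_add_left ((hm x).const_mul _)]
  refine lintegral_mono fun z => ?_
  have h := G.convexOn_ofReal_h.2 (Set.mem_univ (x + z)) (Set.mem_univ (y + z)) ha hb hab
  have hz : a • (x + z) + b • (y + z) = a • x + b • y + z := by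
    rw [smul_add, smul_add, add_add_add_comm, ← add_smul, hab, one_smul]
  rwa [hz] at h

theorem ofReal_h_le_starHold (t : ℕ) (x : ℝ) : ENNReal.ofReal (G.h x) ≤ G.starHold t x :=
  G.convexOn_ofReal_h.le_lintegral_gaussianReal G.measurable_ofReal_h _ x

theorem tendsto_starHold (t : ℕ) (h : Tendsto G.h (cocompact ℝ) atTop) :
    Tendsto (G.starHold t) (cocompact ℝ) (𝓝 ∞) :=
  tendsto_nhds_top_mono (ENNReal.tendsto_ofReal_atTop.comp h)
    (Eventually.of_forall (G.ofReal_h_le_starHold t))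

theorem starHold_ne_top (t : ℕ) (h : ∀ x, G.meanMDP.cost t x 0 ≠ ∞) (x : ℝ) :
    G.starHold t x ≠ ∞ := by
  have hm := G.measurable_starHold t
  have h1 : gaussianReal 0 (G.starVar t) =
      (gaussianReal (G.dMean t) (G.starVar t)).map fun d => G.dMean t - d := by
    rw [gaussianReal_map_const_sub, sub_self]
  have h2 := (G.convexOn_starHold t).le_lintegral_gaussianReal hm (G.starVar t) x
  have hmx : Measurable fun z => G.starHold t (x + z) := by fun_prop
  rw [h1, lintegral_map hmx (by fun_prop)] at h2
  -- Starting from `x + dMean t` without ordering, the next level is `x` plus a centred normal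
  -- variable, so by Jensen the finite cost dominates `h*_t(x)`.
  refine ne_top_of_le_ne_top (h (x + G.dMean t)) (h2.trans ?_)
  rw [meanMDP_cost_eq]
  refine le_add_left (le_of_eq (lintegral_congr fun d => ?_))
  congr 1
  push_cast
  ring

theorem convexOn_toReal_starHold (t : ℕ) (h : ∀ x, G.starHold t x ≠ ∞) :
    ConvexOn ℝ Set.univ fun x => (G.starHold t x).toReal := by
  refine ⟨convex_univ, fun x _ y _ a b ha hb hab => ?_⟩
  lift a to ℝ≥0 using ha
  lift b to ℝ≥0 using hb
  have h1 := (G.convexOn_starHold t).2 (Set.mem_univ x) (Set.mem_univ y)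
    (zero_le : 0 ≤ a) (zero_le : 0 ≤ b) (by exact_mod_cast hab)
  simp only [ENNReal.smul_def, smul_eq_mul] at h1
  have hx : (a : ℝ≥0∞) * G.starHold t x ≠ ∞ := ENNReal.mul_ne_top ENNReal.coe_ne_top (h x)
  have hy : (b : ℝ≥0∞) * G.starHold t y ≠ ∞ := ENNReal.mul_ne_top ENNReal.coe_ne_top (h y)
  have h2 := ENNReal.toReal_mono (ENNReal.add_ne_top.2 ⟨hx, hy⟩) h1
  rw [ENNReal.toReal_add hx hy, ENNReal.toReal_mul, ENNReal.toReal_mul] at h2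
  exact h2

theorem tendsto_toReal_starHold (t : ℕ) (h : ∀ x, G.starHold t x ≠ ∞)
    (hh : Tendsto G.h (cocompact ℝ) atTop) :
    Tendsto (fun x => (G.starHold t x).toReal) (cocompact ℝ) atTop :=
  tendsto_atTop_mono (fun x => (ENNReal.ofReal_le_iff_le_toReal (h x)).1
    (G.ofReal_h_le_starHold t x)) hh

end GaussianInventory

end

/-! ### Assembly of the claims -/

theorem mainTheorem1 (G : GaussianInventory) :
    -- under every policy, posterior distributions of inventory levels are normal
    (∀ (π : Policy ℝ ℝ≥0) (t : ℕ),
      ∀ᵐ h ∂(G.pomdp.law π).map (fun ω => hist t (POMDP.obsTraj ω)),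
        condDistrib (fun ω => (ω t).1.1) (fun ω => hist t (POMDP.obsTraj ω)) (G.pomdp.law π) h =
          gaussianReal (G.meanBelief t h) (G.postVar t)) ∧
    -- mean beliefs: initial distribution, and `x̄_{t+1} = x̄_t + a_t - D*_t` with independent
    -- normal `D*_t`, where `D*_t` does not depend on the history up to the action `a_t`
    (∀ π : Policy ℝ ℝ≥0,
      (G.pomdp.law π).map (fun ω => (G.beliefTraj ω 0).1) =
        gaussianReal G.xMean (G.xVar ^ 2 / (G.xVar + G.nVar 0)) ∧
      (∀ t, (G.pomdp.law π).map (G.starDemand t) = gaussianReal (G.dMean t) (G.starVar t)) ∧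
      iIndepFun G.starDemand (G.pomdp.law π) ∧
      (∀ t, IndepFun (fun ω => (hist t (POMDP.obsTraj ω), (ω t).2)) (G.starDemand t)
        (G.pomdp.law π))) ∧
    -- the filter, the transition probabilities and the costs of the belief MDP on normal beliefs
    (G.pomdp.beliefMDP.init = G.meanMDP.init.map (G.normalBelief 0)) ∧
    (∀ (t : ℕ) (x : ℝ) (a : ℝ≥0),
      (∀ᵐ y ∂(G.pomdp.beliefJoint t).fst (G.normalBelief t x, a),
        G.pomdp.filter t ((G.normalBelief t x, a), y) =
          G.normalBelief (t + 1) (G.nextMean t x a y)) ∧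
      G.pomdp.beliefMDP.trans t (G.normalBelief t x, a) =
        (G.meanMDP.trans t (x, a)).map (G.normalBelief (t + 1)) ∧
      G.pomdp.beliefMDP.cost t (G.normalBelief t x) a = G.meanMDP.cost t x a) ∧
    -- equivalence of the belief MDP and the inventory problem for mean beliefs
    (∀ β : Policy (ProbabilityMeasure ℝ) ℝ≥0,
      G.pomdp.beliefMDP.law β =
        (G.meanMDP.law (β.comap G.toBelief G.measurable_toBelief)).map (trajRelabel G.toBelief) ∧
      ∀ α T, G.pomdp.beliefMDP.value β α T =
        G.meanMDP.value (β.comap G.toBelief G.measurable_toBelief) α T) ∧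
    (∀ ψ : Policy ℝ ℝ≥0,
      G.pomdp.beliefMDP.law
          (ψ.comap GaussianInventory.toMean GaussianInventory.measurable_toMean) =
        (G.meanMDP.law ψ).map (trajRelabel G.toBelief) ∧
      ∀ α T, G.pomdp.beliefMDP.value
          (ψ.comap GaussianInventory.toMean GaussianInventory.measurable_toMean) α T =
        G.meanMDP.value ψ α T) ∧
    -- mean beliefs are sufficient statistics for the partially observable problem
    (∀ π : Policy ℝ ℝ≥0, ∃ ψ : Policy ℝ ℝ≥0,
      (G.pomdp.law π).map G.beliefTraj = G.meanMDP.law ψ ∧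
      ∀ α T, G.pomdp.value π α T = G.meanMDP.value ψ α T) ∧
    (∀ ψ : Policy ℝ ℝ≥0,
      (G.pomdp.law (ψ.comap G.meanBelief G.measurable_meanBelief)).map G.beliefTraj =
        G.meanMDP.law ψ ∧
      ∀ α T, G.pomdp.value (ψ.comap G.meanBelief G.measurable_meanBelief) α T =
        G.meanMDP.value ψ α T) ∧
    -- optimal values and optimal policies
    (∀ (α : ℝ≥0) (T : ℕ∞),
      (⨅ π, G.pomdp.value π α T) = (⨅ ψ, G.meanMDP.value ψ α T) ∧
      (⨅ β, G.pomdp.beliefMDP.value β α T) = (⨅ ψ, G.meanMDP.value ψ α T) ∧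
      ∀ ψ : Policy ℝ ℝ≥0,
        (G.meanMDP.IsOptimal ψ α T ↔
          G.pomdp.IsOptimal (ψ.comap G.meanBelief G.measurable_meanBelief) α T) ∧
        (G.meanMDP.IsOptimal ψ α T ↔
          G.pomdp.beliefMDP.IsOptimal
            (ψ.comap GaussianInventory.toMean GaussianInventory.measurable_toMean) α T)) ∧
    -- the holding costs `h*_t` are convex and coercive, with values in `[0, ∞]` in general and
    -- with finite values if the one-step costs are finite
    (∀ t : ℕ,
      ConvexOn ℝ≥0 Set.univ (G.starHold t) ∧
      (Tendsto G.h (cocompact ℝ) atTop → Tendsto (G.starHold t) (cocompact ℝ) (𝓝 ∞)) ∧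
      ((∀ x, G.meanMDP.cost t x 0 ≠ ∞) →
        (∀ x, G.starHold t x ≠ ∞) ∧
        ConvexOn ℝ Set.univ (fun x => (G.starHold t x).toReal) ∧
        (Tendsto G.h (cocompact ℝ) atTop →
          Tendsto (fun x => (G.starHold t x).toReal) (cocompact ℝ) atTop))) := by
  have hbelief (ψ : Policy ℝ ℝ≥0) (α : ℝ≥0) (T : ℕ∞) : G.pomdp.beliefMDP.value
      (ψ.comap GaussianInventory.toMean GaussianInventory.measurable_toMean) α T =
        G.meanMDP.value ψ α T := by
    rw [G.beliefMDP_value_eq, G.comap_toMean_comap_toBelief]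
  have hpomdp (ψ : Policy ℝ ℝ≥0) (α : ℝ≥0) (T : ℕ∞) :
      G.pomdp.value (ψ.comap G.meanBelief G.measurable_meanBelief) α T = G.meanMDP.value ψ α T :=
    G.pomdp_value_eq (G.map_beliefTraj_comap ψ) α T
  have hmean (π : Policy ℝ ℝ≥0) : ∃ ψ : Policy ℝ ℝ≥0,
      (G.pomdp.law π).map G.beliefTraj = G.meanMDP.law ψ ∧
      ∀ α T, G.pomdp.value π α T = G.meanMDP.value ψ α T := by
    obtain ⟨ψ, hψ⟩ := G.exists_policy_map_beliefTraj π
    exact ⟨ψ, hψ, G.pomdp_value_eq hψ⟩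
  refine ⟨fun π t => ?_, fun π => ⟨G.map_beliefTraj_zero π, fun t => ?_, G.iIndepFun_starDemand π,
    fun t => (G.hasCondDistrib_starDemand π t).indepFun⟩, G.beliefMDP_init,
    fun t x a => ⟨G.filter_ae_eq t x a, G.beliefMDP_trans_normalBelief t x a,
      G.beliefMDP_cost_normalBelief t x a⟩,
    fun β => ⟨G.beliefMDP_law_eq β, G.beliefMDP_value_eq β⟩, fun ψ => ⟨?_, hbelief ψ⟩, hmean,
    fun ψ => ⟨G.map_beliefTraj_comap ψ, hpomdp ψ⟩, fun α T => ⟨?_, ?_, fun ψ => ⟨?_, ?_⟩⟩,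
    fun t => ⟨G.convexOn_starHold t, G.tendsto_starHold t, fun h => ⟨G.starHold_ne_top t h,
      G.convexOn_toReal_starHold t (G.starHold_ne_top t h),
      G.tendsto_toReal_starHold t (G.starHold_ne_top t h)⟩⟩⟩
  · have h := G.hasCondDistrib_posterior π t
    exact condDistrib_ae_eq_of_measure_eq_compProd _ h.aemeasurable_snd h.map_eq
  · exact (G.hasCondDistrib_starDemand π t).hasLaw_of_const.map_eq
  · rw [G.beliefMDP_law_eq, G.comap_toMean_comap_toBelief]
  · refine le_antisymm (le_iInf fun ψ => (iInf_le _ _).trans_eq (hpomdp ψ α T))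
      (le_iInf fun π => ?_)
    obtain ⟨ψ, -, hψ⟩ := hmean π
    exact (iInf_le _ ψ).trans_eq (hψ α T).symm
  · refine le_antisymm (le_iInf fun ψ => (iInf_le _ _).trans_eq (hbelief ψ α T))
      (le_iInf fun β => ?_)
    exact (iInf_le _ _).trans_eq (G.beliefMDP_value_eq β α T).symm
  -- A competitor `π` is replaced by an equally costly `ψ'` of the mean MDP; conversely `ψ'`
  -- competes through its application to mean beliefs.
  · refine ⟨fun h π => ?_, fun h ψ' => ?_⟩
    · obtain ⟨ψ', -, hψ'⟩ := hmean π
      rw [hpomdp, hψ']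
      exact h ψ'
    · rw [← hpomdp ψ, ← hpomdp ψ']
      exact h _
  · refine ⟨fun h β => ?_, fun h ψ' => ?_⟩
    · rw [hbelief, G.beliefMDP_value_eq]
      exact h _
    · rw [← hbelief ψ, ← hbelief ψ']
      exact h _
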